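/- Let $\nu$ be a Lévy measure on $\mathbb{R}$ (that is, $\nu(\{0\})=0$ and $\int \min(1,x^2)\,\nu(dx)<\infty$), let $T>0$, and let $\mu$ be a Poisson random measure on $[0,T]\times\mathbb{R}$ with intensity $dt\,\nu(dx)$ on a probability space $(\Omega,\mathcal F,P)$, with compensated measure $\tilde\mu(dx,dt)=\mu(dx,dt)-\nu(dx)\,dt$. Write $f\sim g$ if $f=O(g)$ and $g=O(f)$. Assume (A1): for some $\alpha\in[0,2]$, $\int_{|x|\le\varepsilon}x^2\,\nu(dx)\sim\varepsilon^{2-\alpha}$ as $\varepsilon\downarrow0$; assume moreover $\alpha\neq0$. Let $0<u\le 1/2$ and $c\in\mathbb{R}$; for $n\in\mathbb{N}$ put $h=T/n$, $t_i=ih$, $\varepsilon=h^u$, and $$\ell_{j,h}=\frac{\int_{|x|\le\varepsilon}x^j\,\nu(dx)}{\varepsilon^{j-\alpha}}\ (j=2,4),\qquad \ell_{1,h}=\frac{\int_{\varepsilon<|x|\le1}x\,\nu(dx)}{(c+\varepsilon^{1-\alpha})1_{\{\alpha\ne1\}}+\ln\frac1{2\varepsilon}\,1_{\{\alpha=1\}}}.$$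 Then, as $h\to0$ (i.e. $n\to\infty$), $$\frac{\displaystyle\sum_{i=1}^n\Big(\int_{t_{i-1}}^{t_i}\!\int_{|x|\le\varepsilon}x\,\tilde\mu(dx,dt)-\int_{t_{i-1}}^{t_i}\!\int_{\varepsilon<|x|\le1}x\,\nu(dx)\,dt\Big)^2-T\ell_{2,h}\varepsilon^{2-\alpha}-T\ell_{1,h}^2\,h\,\varepsilon^{2-2\alpha}1_{\{\alpha\ne1\}}}{\sqrt T\,\sqrt{\ell_{4,h}}\;\varepsilon^{2-\alpha/2}}\ \xrightarrow{\ d\ }\ N(0,1).$$ Moreover, as $h\downarrow0$, $\ell_{2,h}$ and $\ell_{4,h}$ are bounded and bounded away from $0$, and, if $c\ne0$, $\ell_{1,h}$ is bounded. -/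

import Mathlib

open MeasureTheory ProbabilityTheory Filter Asymptotics
open scoped Topology ENNReal NNReal

noncomputable section

/-- `ν` is a Lévy measure on `ℝ`. -/
structure IsLevyMeasure (ν : Measure ℝ) : Prop where
  zero : ν {0} = 0
  lintegral_lt_top : ∫⁻ x, ENNReal.ofReal (min 1 (x ^ 2)) ∂ν < ∞

/-- `N` is, under `P`, a Poisson random measure on `E` with intensity measure `m`. -/
structure IsPoissonRandomMeasure {Ω E : Type*} [MeasurableSpace Ω] [MeasurableSpace E]
    (P : Measure Ω) (N : Ω → Measure E) (m : Measure E) : Prop where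
  measurable : Measurable N
  map_of_lt_top : ∀ A : Set E, MeasurableSet A → m A < ∞ →
    P.map (fun ω => N ω A) = (poissonMeasure (m A).toNNReal).map (fun k : ℕ => (k : ℝ≥0∞))
  ae_eq_top : ∀ A : Set E, MeasurableSet A → m A = ∞ → ∀ᵐ ω ∂P, N ω A = ∞
  iIndepFun : ∀ A : ℕ → Set E, (∀ i, MeasurableSet (A i)) →
    Pairwise (fun i j => Disjoint (A i) (A j)) → iIndepFun (fun i ω => N ω (A i)) P

/-- The jump sizes `x` with `a < |x| ≤ b`. -/
def jumpShell (a b : ℝ) : Set ℝ := {x | a < |x| ∧ |x| ≤ b}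

/-- `∫_{(s,t]} ∫_{δ < |x| ≤ ε} x (N(dr, dx) - dr ν(dx))` for `δ > 0`
(points of `N` are pairs (time, jump size)). -/
def compShell {Ω : Type*} (N : Ω → Measure (ℝ × ℝ)) (ν : Measure ℝ) (s t ε δ : ℝ) (ω : Ω) : ℝ :=
  (∫ z in Set.Ioc s t ×ˢ jumpShell δ ε, z.2 ∂(N ω)) - (t - s) * ∫ x in jumpShell δ ε, x ∂ν

/-- `Z` is the limit in `L²(P)`, as `δ ↓ 0`, of the compensated integrals of the jumps with
`δ < |x| ≤ ε` over the time interval `(s, t]`. -/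
def IsCompSmallJumps {Ω : Type*} [MeasurableSpace Ω] (P : Measure Ω) (N : Ω → Measure (ℝ × ℝ))
    (ν : Measure ℝ) (s t ε : ℝ) (Z : Ω → ℝ) : Prop :=
  MemLp Z 2 P ∧
    Tendsto (fun δ => eLpNorm (fun ω => compShell N ν s t ε δ ω - Z ω) 2 P) (𝓝[>] 0) (𝓝 0)

open Classical in
/-- The compensated small-jump integral `∫_s^t ∫_{|x| ≤ ε} x (N(dr, dx) - dr ν(dx))`,
as an `L²` limit (unique up to a null set). -/
def compSmallJumps {Ω : Type*} [MeasurableSpace Ω] (P : Measure Ω) (N : Ω → Measure (ℝ × ℝ))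
    (ν : Measure ℝ) (s t ε : ℝ) : Ω → ℝ :=
  if H : ∃ Z : Ω → ℝ, IsCompSmallJumps P N ν s t ε Z then H.choose else 0

/-- `∫_{|x| ≤ ε} x ^ j ν(dx)`. -/
def smallMoment (ν : Measure ℝ) (j : ℕ) (ε : ℝ) : ℝ := ∫ x in {x : ℝ | |x| ≤ ε}, x ^ j ∂ν

/-- `∫_{ε < |x| ≤ 1} x ν(dx)`. -/
def midDrift (ν : Measure ℝ) (ε : ℝ) : ℝ := ∫ x in jumpShell ε 1, x ∂ν

/-- Assumption A1 with index `α`: `∫_{|x| ≤ ε} x² ν(dx)` and `ε ^ (2 - α)` are each a big-O of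
the other as `ε ↓ 0`. -/
def AssumptionA1 (ν : Measure ℝ) (α : ℝ) : Prop :=
  α ∈ Set.Icc (0 : ℝ) 2 ∧
    (fun ε : ℝ => smallMoment ν 2 ε) =Θ[𝓝[>] 0] (fun ε : ℝ => ε ^ (2 - α))

/-- `ℓ_j` (used for `j = 2, 4`) as a function of the truncation level `ε`. -/
def ell (ν : Measure ℝ) (α : ℝ) (j : ℕ) (ε : ℝ) : ℝ := smallMoment ν j ε / ε ^ ((j : ℝ) - α)

open Classical in
/-- `ℓ_1` as a function of the truncation level `ε`. -/
def ellOne (ν : Measure ℝ) (α c ε : ℝ) : ℝ :=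
  midDrift ν ε / (if α = 1 then Real.log (1 / (2 * ε)) else c + ε ^ (1 - α))

/-- `∑ᵢ (∫_{tᵢ₋₁}^{tᵢ} ∫_{|x| ≤ ε} x μ̃(dx, dt) - ∫_{tᵢ₋₁}^{tᵢ} ∫_{ε < |x| ≤ 1} x ν(dx) dt)²` over the
grid `tᵢ = i h`, `i = 0, …, n`. -/
def sumSqIncrements {Ω : Type*} [MeasurableSpace Ω] (P : Measure Ω) (N : Ω → Measure (ℝ × ℝ))
    (ν : Measure ℝ) (n : ℕ) (h ε : ℝ) (ω : Ω) : ℝ :=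
  ∑ i ∈ Finset.range n,
    (compSmallJumps P N ν ((i : ℝ) * h) (((i : ℝ) + 1) * h) ε ω
      - ∫ _ in ((i : ℝ) * h)..(((i : ℝ) + 1) * h), midDrift ν ε) ^ 2

open Classical in
/-- The centred and scaled sum of squares. -/
def normalizedSum {Ω : Type*} [MeasurableSpace Ω] (P : Measure Ω) (N : Ω → Measure (ℝ × ℝ))
    (ν : Measure ℝ) (T α c : ℝ) (n : ℕ) (h ε : ℝ) (ω : Ω) : ℝ :=
  (sumSqIncrements P N ν n h ε ω
      - T * ell ν α 2 ε * ε ^ (2 - α)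
      - T * ellOne ν α c ε ^ 2 * h * ε ^ (2 - 2 * α) * (if α = 1 then 0 else 1))
    / (√T * √(ell ν α 4 ε) * ε ^ (2 - α / 2))

end

/-! Write `h = T / n`, `mⱼ` for `smallMoment ν j ε`, `d` for `midDrift ν ε` and `Zᵢ` for the
compensated small-jump increments. The powers of `ε` in `ell` cancel, so the variable under study is
`∑ (Zᵢ - h d)²`, centred by `T m₂` and the drift correction, over `√(T m₄)`.

Expanding the square gives `∑ Zᵢ²`, a cross term `-2 h d ∑ Zᵢ` and the constant `T h d²`. The first
sum is close to the quadratic variation `Q`, the sum of the squared jumps: `∑ Zᵢ² - Q` is a double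
Poisson integral of variance `2 ∑ (h m₂)² = 2 T h m₂²` (`hasExpectation_sum_sq_sub_quadVar`). The
variable `Q` is a Poisson integral of `x²`, with mean `T m₂`, variance `T m₄` and an explicit
characteristic function. A second-order expansion of its exponent gives the Gaussian limit as soon
as `ε² / √m₄ → 0` (`tendstoInDistribution_quadVar`).

Everything is then a comparison of exponents. A1 forces `α < 2` and `m₄ ≍ ε ^ (4 - α)`
(`smallMoment_four_isTheta`), so the scale is `ε ^ (2 - α / 2)`. The condition on `ε²` is `α > 0`.
Since `u ≤ 1 / 2` gives `h ≤ ε²` eventually, `√h m₂` is `O(ε ^ (3 - α))`, negligible because `α <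
2`. The cross term and the error of centring with `ellOne` are controlled by a layer-cake bound on
`d` (`exists_abs_midDrift_le`).

The `Zᵢ` exist only as `L²` limits, so the work is done on shells `δ < |x| ≤ ε`, which carry almost
surely finitely many jumps, and `δ` is chosen at the end, separately for each `n`, so small that it
costs nothing. On a shell the identities are proved for finitely many independent Poisson counts,
hence for simple functions, and pass to bounded functions by Fatou's lemma or dominated convergence.
-/

/-- `f` is integrable with integral `a`. -/
def HasExpectation {Ω : Type*} [MeasurableSpace Ω] (μ : Measure Ω) (f : Ω → ℝ) (a : ℝ) : Prop :=
  Integrable f μ ∧ ∫ ω, f ω ∂μ = a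

/-! ### Calculus of expectations that carry their integrability -/

namespace HasExpectation

variable {Ω : Type*} [MeasurableSpace Ω] {μ : Measure Ω} {f g : Ω → ℝ} {a b : ℝ}

lemma add (hf : HasExpectation μ f a) (hg : HasExpectation μ g b) :
    HasExpectation μ (fun ω => f ω + g ω) (a + b) :=
  ⟨hf.1.add hg.1, by rw [integral_add hf.1 hg.1, hf.2, hg.2]⟩

lemma const_mul (c : ℝ) (hf : HasExpectation μ f a) :
    HasExpectation μ (fun ω => c * f ω) (c * a) :=
  ⟨hf.1.const_mul c, by rw [integral_const_mul, hf.2]⟩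

lemma const [IsProbabilityMeasure μ] (c : ℝ) : HasExpectation μ (fun _ => c) c :=
  ⟨integrable_const c, by simp⟩

lemma congr (hf : HasExpectation μ f a) (h : ∀ ω, g ω = f ω) (hab : b = a) :
    HasExpectation μ g b := by
  obtain rfl : g = f := funext h
  exact hab ▸ hf

lemma mul_of_indepFun (h : IndepFun f g μ) (hf : HasExpectation μ f a)
    (hg : HasExpectation μ g b) : HasExpectation μ (fun ω => f ω * g ω) (a * b) :=
  ⟨h.integrable_mul hf.1 hg.1, by
    rw [h.integral_fun_mul_eq_mul_integral hf.1.1 hg.1.1, hf.2, hg.2]⟩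

lemma comp_hasLaw {E : Type*} [MeasurableSpace E] {κ : Measure E} {X : Ω → E} {φ : E → ℝ}
    (hX : HasLaw X κ μ) (h : HasExpectation κ φ a) : HasExpectation μ (fun ω => φ (X ω)) a := by
  obtain ⟨h1, h2⟩ := h
  rw [← hX.map_eq] at h1 h2
  exact ⟨(integrable_map_measure h1.1 hX.aemeasurable).1 h1, by
    rw [← integral_map hX.aemeasurable h1.1, h2]⟩

lemma of_map {E : Type*} [MeasurableSpace E] {X : Ω → E} {φ : E → ℝ} (hX : AEMeasurable X μ)
    (hφ : AEStronglyMeasurable φ (μ.map X)) (h : HasExpectation μ (fun ω => φ (X ω)) a) :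
    HasExpectation (μ.map X) φ a :=
  ⟨(integrable_map_measure hφ hX).2 h.1, by rw [integral_map hX hφ, h.2]⟩

end HasExpectation

/-! ### Moments of the Poisson law -/

section PoissonMoments

/-- For real series summability is absolute, so convergence of the series already contains
integrability. -/
lemma hasExpectation_poissonMeasure_iff {r : ℝ≥0} {f : ℕ → ℝ} {a : ℝ} :
    HasExpectation (poissonMeasure r) f a ↔
      HasSum (fun n => Real.exp (-r) * r ^ n / n.factorial * f n) a := by
  constructor
  · rintro ⟨h, rfl⟩
    exact hasSum_integral_poissonMeasure h
  · intro h
    have hi : Integrable f (poissonMeasure r) := by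
      rw [integrable_poissonMeasure_iff]
      refine h.summable.abs.congr fun n => ?_
      rw [abs_mul, Real.norm_eq_abs, abs_of_nonneg (by positivity)]
    exact ⟨hi, (hasSum_integral_poissonMeasure hi).unique h⟩

/-- Size biasing: `n rⁿ / n! = r · rⁿ⁻¹ / (n - 1)!`. Iterating it yields the factorial moments. -/
lemma hasExpectation_poissonMeasure_mul {r : ℝ≥0} {f : ℕ → ℝ} {a : ℝ}
    (h : HasExpectation (poissonMeasure r) (fun n => f (n + 1)) a) :
    HasExpectation (poissonMeasure r) (fun n => n * f n) (r * a) := by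
  rw [hasExpectation_poissonMeasure_iff] at h ⊢
  have h1 := h.mul_left (r : ℝ)
  rw [← add_zero ((r : ℝ) * a)]
  have := (hasSum_nat_add_iff (f := fun n : ℕ => Real.exp (-r) * r ^ n / n.factorial * (n * f n))
    (g := (r : ℝ) * a) 1).1 ?_
  · simpa using this
  · have he : ∀ n : ℕ, Real.exp (-r) * r ^ (n + 1) / (n + 1).factorial * (((n + 1 : ℕ) : ℝ) * f (n + 1)) =
        r * (Real.exp (-r) * r ^ n / n.factorial * f (n + 1)) := by
      intro n
      rw [Nat.factorial_succ]
      push_cast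
      field_simp
      ring
    simp only [he]
    simpa using h1

lemma hasExpectation_poissonMeasure_fun (r : ℝ≥0) :
    HasExpectation (poissonMeasure r) (fun n => (n : ℝ)) r ∧
    HasExpectation (poissonMeasure r) (fun n => (n : ℝ) * (n - 1)) (r ^ 2) ∧
    HasExpectation (poissonMeasure r) (fun n => (n : ℝ) * ((n - 1) * (n - 2))) (r ^ 3) ∧
    HasExpectation (poissonMeasure r) (fun n => (n : ℝ) * ((n - 1) * ((n - 2) * (n - 3))))
      (r ^ 4) := by
  have h0 := HasExpectation.const (μ := poissonMeasure r) 1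
  have h1 : HasExpectation (poissonMeasure r) (fun n => (n : ℝ)) r :=
    (hasExpectation_poissonMeasure_mul (f := fun _ => 1) h0).congr (by simp) (by simp)
  have h2 := hasExpectation_poissonMeasure_mul (f := fun n => (n : ℝ) - 1)
    (h1.congr (fun n => by push_cast; ring) rfl)
  have h3 := hasExpectation_poissonMeasure_mul (f := fun n => ((n : ℝ) - 1) * (n - 2))
    (h2.congr (fun n => by push_cast; ring) rfl)
  have h4 := hasExpectation_poissonMeasure_mul (f := fun n => ((n : ℝ) - 1) * ((n - 2) * (n - 3)))
    (h3.congr (fun n => by push_cast; ring) rfl)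
  exact ⟨h1, h2.congr (fun _ => rfl) (by ring), h3.congr (fun _ => rfl) (by ring),
    h4.congr (fun _ => rfl) (by ring)⟩

lemma hasExpectation_poissonMeasure_centered (r : ℝ≥0) :
    HasExpectation (poissonMeasure r) (fun n => (n : ℝ) - r) 0 ∧
    HasExpectation (poissonMeasure r) (fun n => ((n : ℝ) - r) ^ 2) r ∧
    HasExpectation (poissonMeasure r) (fun n => ((n : ℝ) - r) ^ 2 - n) 0 ∧
    HasExpectation (poissonMeasure r) (fun n => (((n : ℝ) - r) ^ 2 - n) ^ 2) (2 * r ^ 2) := by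
  obtain ⟨h1, h2, h3, h4⟩ := hasExpectation_poissonMeasure_fun r
  have hc := HasExpectation.const (μ := poissonMeasure r)
  refine ⟨(h1.add (hc (-r))).congr (fun n => by ring) (by ring),
    ((h2.add (h1.const_mul (1 - 2 * r))).add (hc (r ^ 2))).congr (fun n => by ring) (by ring),
    ((h2.add (h1.const_mul (- 2 * r))).add (hc (r ^ 2))).congr (fun n => by ring) (by ring),
    -- The coefficients expand `(n (n - 1) - 2 r n + r²)²` in falling factorials of `n`.
    ((((h4.add (h3.const_mul (4 - 4 * r))).add (h2.const_mul (2 + 6 * r ^ 2 - 8 * r))).add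
      (h1.const_mul (4 * r ^ 2 - 4 * r ^ 3))).add (hc (r ^ 4))).congr
      (fun n => by ring) (by ring)⟩

lemma hasExpectation_of_hasLaw_poisson {Ω : Type*} [MeasurableSpace Ω] {P : Measure Ω}
    {X : Ω → ℝ} {r : ℝ≥0} (hX : HasLaw X ((poissonMeasure r).map (Nat.cast : ℕ → ℝ)) P) :
    HasExpectation P (fun ω => X ω - r) 0 ∧
    HasExpectation P (fun ω => (X ω - r) ^ 2) r ∧
    HasExpectation P (fun ω => (X ω - r) ^ 2 - X ω) 0 ∧
    HasExpectation P (fun ω => ((X ω - r) ^ 2 - X ω) ^ 2) (2 * r ^ 2) := by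
  obtain ⟨h1, h2, h3, h4⟩ := hasExpectation_poissonMeasure_centered r
  have key : ∀ {φ : ℝ → ℝ} {a : ℝ}, Measurable φ →
      HasExpectation (poissonMeasure r) (fun n => φ n) a → HasExpectation P (fun ω => φ (X ω)) a :=
    fun hφ h => HasExpectation.comp_hasLaw hX
      (HasExpectation.of_map .of_discrete hφ.aestronglyMeasurable h)
  exact ⟨key (φ := fun x => x - r) (by fun_prop) h1, key (φ := fun x => (x - r) ^ 2)
    (by fun_prop) h2, key (φ := fun x => (x - r) ^ 2 - x) (by fun_prop) h3,
    key (φ := fun x => ((x - r) ^ 2 - x) ^ 2) (by fun_prop) h4⟩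

end PoissonMoments

/-! ### Finite families of independent Poisson variables -/

section FiniteFamily

variable {Ω J ι : Type*} [MeasurableSpace Ω] {P : Measure Ω} [IsProbabilityMeasure P]

omit [IsProbabilityMeasure P] in
lemma memLp_two_of_hasExpectation_sq {f : Ω → ℝ} {a : ℝ} (hf : AEStronglyMeasurable f P)
    (h : HasExpectation P (fun ω => f ω ^ 2) a) : MemLp f 2 P :=
  (memLp_two_iff_integrable_sq hf).2 h.1

omit [IsProbabilityMeasure P] in
/-- Second moments after adding an independent centred Poisson contribution. -/
lemma hasExpectation_chaos_step {X S Z : Ω → ℝ} {r : ℝ≥0} {s v : ℝ} (c : ℝ)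
    (hX : HasLaw X ((poissonMeasure r).map (Nat.cast : ℕ → ℝ)) P)
    (hind : IndepFun X (fun ω => (S ω, Z ω)) P)
    (hSm : AEStronglyMeasurable S P) (hZm : AEStronglyMeasurable Z P)
    (hS : HasExpectation P S 0) (hS2 : HasExpectation P (fun ω => S ω ^ 2) s)
    (hZ : HasExpectation P Z 0) (hZ2 : HasExpectation P (fun ω => Z ω ^ 2) v) :
    HasExpectation P
      (fun ω => S ω + (2 * (c * (X ω - r)) * Z ω + c ^ 2 * ((X ω - r) ^ 2 - X ω))) 0 ∧
    HasExpectation P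
      (fun ω => (S ω + (2 * (c * (X ω - r)) * Z ω + c ^ 2 * ((X ω - r) ^ 2 - X ω))) ^ 2)
      (s - 2 * v ^ 2 + 2 * (v + c ^ 2 * r) ^ 2) ∧
    HasExpectation P (fun ω => Z ω + c * (X ω - r)) 0 ∧
    HasExpectation P (fun ω => (Z ω + c * (X ω - r)) ^ 2) (v + c ^ 2 * r) := by
  obtain ⟨hV, hV2, hU, hU2⟩ := hasExpectation_of_hasLaw_poisson hX
  have hXm := hX.aemeasurable
  have hSL := memLp_two_of_hasExpectation_sq hSm hS2
  have hZL := memLp_two_of_hasExpectation_sq hZm hZ2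
  have hVL : MemLp (fun ω => X ω - r) 2 P :=
    memLp_two_of_hasExpectation_sq (by fun_prop) hV2
  have hUL : MemLp (fun ω => (X ω - r) ^ 2 - X ω) 2 P :=
    memLp_two_of_hasExpectation_sq (by fun_prop) hU2
  have hSZ : HasExpectation P (fun ω => S ω * Z ω) (∫ ω, S ω * Z ω ∂P) :=
    ⟨hSL.integrable_mul hZL, rfl⟩
  have hUV : HasExpectation P (fun ω => ((X ω - r) ^ 2 - X ω) * (X ω - r))
      (∫ ω, ((X ω - r) ^ 2 - X ω) * (X ω - r) ∂P) := ⟨hUL.integrable_mul hVL, rfl⟩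
  have ind : ∀ {φ : ℝ → ℝ} {ψ : ℝ × ℝ → ℝ}, Measurable φ → Measurable ψ →
      IndepFun (fun ω => φ (X ω)) (fun ω => ψ (S ω, Z ω)) P := fun hφ hψ => hind.comp hφ hψ
  -- With `V = X - r` and `U = V² - X`, every mixed product except `V² Z²` contains a centred factor
  -- independent of the rest, so the unknown values of `E[S Z]` and `E[U V]` are multiplied by zero.
  -- The second moment grows by `4 c² r v + 2 c⁴ r² = 2 (v + c² r)² - 2 v²`.
  have e1 := HasExpectation.mul_of_indepFun
    (ind (φ := fun x => x - r) (ψ := fun p => p.2) (by fun_prop) (by fun_prop)) hV hZ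
  have e2 := HasExpectation.mul_of_indepFun
    (ind (φ := fun x => (x - r) ^ 2) (ψ := fun p => p.2 ^ 2) (by fun_prop) (by fun_prop)) hV2 hZ2
  have e3 := HasExpectation.mul_of_indepFun
    (ind (φ := fun x => (x - r)) (ψ := fun p => p.1 * p.2) (by fun_prop) (by fun_prop)) hV hSZ
  have e4 := HasExpectation.mul_of_indepFun
    (ind (φ := fun x => (x - r) ^ 2 - x) (ψ := fun p => p.1) (by fun_prop) (by fun_prop)) hU hS
  have e5 := HasExpectation.mul_of_indepFun
    (ind (φ := fun x => ((x - r) ^ 2 - x) * (x - r)) (ψ := fun p => p.2)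
      (by fun_prop) (by fun_prop)) hUV hZ
  refine ⟨((hS.add (e1.const_mul (2 * c))).add (hU.const_mul (c ^ 2))).congr
      (fun ω => by ring) (by ring),
    (((((hS2.add (e2.const_mul (4 * c ^ 2))).add (hU2.const_mul (c ^ 4))).add
      (e3.const_mul (4 * c))).add (e4.const_mul (2 * c ^ 2))).add (e5.const_mul (4 * c ^ 3))).congr
      (fun ω => by ring) (by ring),
    (hZ.add (hV.const_mul c)).congr (fun ω => by ring) (by ring),
    ((hZ2.add (e1.const_mul (2 * c))).add (hV2.const_mul (c ^ 2))).congr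
      (fun ω => by ring) (by ring)⟩

/-- `∑ i, (Z i ^ 2 - [Z] i)` for compensated sums `Z i` of independent Poisson variables, grouped
by `g`, with quadratic variation `[Z]`. -/
lemma hasExpectation_sum_sq_sub_quadVar [DecidableEq J] [Fintype ι] [DecidableEq ι]
    {X : J → Ω → ℝ} {r : J → ℝ≥0}
    (hX : ∀ a, HasLaw (X a) ((poissonMeasure (r a)).map (Nat.cast : ℕ → ℝ)) P)
    (hXm : ∀ a, Measurable (X a)) (hind : iIndepFun X P) (c : J → ℝ) (g : J → ι) (s : Finset J) :
    (∀ i, HasExpectation P (fun ω => ∑ a ∈ s, if g a = i then c a * (X a ω - r a) else 0) 0 ∧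
      HasExpectation P (fun ω => (∑ a ∈ s, if g a = i then c a * (X a ω - r a) else 0) ^ 2)
        (∑ a ∈ s, if g a = i then c a ^ 2 * r a else 0)) ∧
    HasExpectation P (fun ω => ∑ i, (∑ a ∈ s, if g a = i then c a * (X a ω - r a) else 0) ^ 2
      - ∑ a ∈ s, c a ^ 2 * X a ω) 0 ∧
    HasExpectation P (fun ω => (∑ i, (∑ a ∈ s, if g a = i then c a * (X a ω - r a) else 0) ^ 2
      - ∑ a ∈ s, c a ^ 2 * X a ω) ^ 2)
      (2 * ∑ i, (∑ a ∈ s, if g a = i then c a ^ 2 * r a else 0) ^ 2) := by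
  -- Adding the variable `a` alters only the group `g a`, whose square grows by `2 Z V + V²`; after
  -- subtraction of `c² X` the increment is centred and orthogonal to the past, so the second
  -- moments add up.
  induction s using Finset.induction_on with
  | empty =>
    have := HasExpectation.const (μ := P) 0
    simpa using ⟨fun _ : ι => this, this⟩
  | insert a s ha ih =>
    obtain ⟨ih1, ih2, ih3⟩ := ih
    have hindep : IndepFun (X a) (fun ω =>
        (∑ i, (∑ a ∈ s, if g a = i then c a * (X a ω - r a) else 0) ^ 2 - ∑ a ∈ s, c a ^ 2 * X a ω,
          ∑ b ∈ s, if g b = g a then c b * (X b ω - r b) else 0)) P := by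
      have h := hind.indepFun_finset {a} s (by simpa using ha) hXm
      have hev : Measurable fun x : ({a} : Finset J) → ℝ => x ⟨a, by simp⟩ :=
        measurable_pi_apply _
      have hmeas : ∀ i, Measurable fun x : s → ℝ =>
          ∑ b : s, if g b = i then c b * (x b - r b) else 0 := fun i =>
        Finset.measurable_sum _ fun b _ => by split_ifs <;> fun_prop
      have hψ : Measurable fun x : s → ℝ =>
          (∑ i, (∑ b : s, if g b = i then c b * (x b - r b) else 0) ^ 2
            - ∑ b : s, c b ^ 2 * x b, ∑ b : s, if g b = g a then c b * (x b - r b) else 0) := by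
        have := hmeas (g a)
        fun_prop
      have h2 := h.comp hev hψ
      refine h2.congr (ae_of_all _ fun _ => rfl) (ae_of_all _ fun ω => ?_)
      simp only [Function.comp]
      rw [Finset.sum_coe_sort s (fun b => if g b = g a then c b * (X b ω - r b) else 0),
        Finset.sum_coe_sort s (fun b => c b ^ 2 * X b ω)]
      congr 2
      refine Finset.sum_congr rfl fun i _ => ?_
      rw [Finset.sum_coe_sort s (fun b => if g b = i then c b * (X b ω - r b) else 0)]
    have hZm : ∀ i, Measurable fun ω => ∑ b ∈ s, if g b = i then c b * (X b ω - r b) else 0 :=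
      fun i => Finset.measurable_sum _ fun b _ => by
        have := hXm b
        split_ifs <;> fun_prop
    obtain ⟨k1, k2, k3, k4⟩ := hasExpectation_chaos_step (c a) (hX a) hindep ih2.1.1
      (hZm _).aestronglyMeasurable ih2 ih3 (ih1 (g a)).1 (ih1 (g a)).2
    have hfun : ∀ ω, ∑ i, (∑ b ∈ insert a s, if g b = i then c b * (X b ω - r b) else 0) ^ 2
        - ∑ b ∈ insert a s, c b ^ 2 * X b ω =
        (∑ i, (∑ a ∈ s, if g a = i then c a * (X a ω - r a) else 0) ^ 2 - ∑ a ∈ s, c a ^ 2 * X a ω)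
        + (2 * (c a * (X a ω - r a)) * (∑ b ∈ s, if g b = g a then c b * (X b ω - r b) else 0)
        + c a ^ 2 * ((X a ω - r a) ^ 2 - X a ω)) := by
      intro ω
      have : ∀ i, (∑ b ∈ insert a s, if g b = i then c b * (X b ω - r b) else 0) ^ 2 =
          (∑ b ∈ s, if g b = i then c b * (X b ω - r b) else 0) ^ 2 +
          if g a = i then 2 * (c a * (X a ω - r a)) *
            (∑ b ∈ s, if g b = i then c b * (X b ω - r b) else 0) + (c a * (X a ω - r a)) ^ 2
          else 0 := by
        intro i
        rw [Finset.sum_insert ha]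
        split_ifs <;> ring
      simp_rw [this, Finset.sum_insert ha, Finset.sum_add_distrib]
      rw [Finset.sum_ite_eq Finset.univ (g a), if_pos (Finset.mem_univ _)]
      ring
    refine ⟨fun i => ?_, k1.congr hfun rfl, k2.congr (fun ω => by rw [hfun]) ?_⟩
    · simp_rw [Finset.sum_insert ha]
      by_cases hi : g a = i
      · subst hi
        simp only [if_true]
        exact ⟨k3.congr (fun ω => by ring) rfl, k4.congr (fun ω => by ring) (by ring)⟩
      · simp only [if_neg hi, zero_add]
        exact ih1 i
    · have : ∀ i, (∑ b ∈ insert a s, if g b = i then c b ^ 2 * (r b : ℝ) else 0) ^ 2 =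
          (∑ b ∈ s, if g b = i then c b ^ 2 * (r b : ℝ) else 0) ^ 2 +
          if g a = i then 2 * (c a ^ 2 * r a) *
            (∑ b ∈ s, if g b = i then c b ^ 2 * (r b : ℝ) else 0) + (c a ^ 2 * r a) ^ 2
          else 0 := by
        intro i
        rw [Finset.sum_insert ha]
        split_ifs <;> ring
      simp_rw [this, Finset.sum_add_distrib]
      rw [Finset.sum_ite_eq Finset.univ (g a), if_pos (Finset.mem_univ _)]
      ring

omit [IsProbabilityMeasure P] in
lemma charFun_sum_poisson [Fintype J] {X : J → Ω → ℝ} {r : J → ℝ≥0}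
    (hX : ∀ a, HasLaw (X a) ((poissonMeasure (r a)).map (Nat.cast : ℕ → ℝ)) P)
    (hind : iIndepFun X P) (c : J → ℝ) (t : ℝ) :
    charFun (P.map fun ω => ∑ a, c a * X a ω) t =
      Complex.exp (∑ a, r a * (Complex.exp ((t * c a : ℝ) * Complex.I) - 1)) := by
  have hi : iIndepFun (fun a ω => c a * X a ω) P :=
    hind.comp (fun a x => c a * x) (fun a => by fun_prop)
  rw [hi.charFun_map_fun_sum_eq_prod (fun a => (hX a).aemeasurable.const_mul _), Complex.exp_sum,
    Finset.prod_apply]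
  refine Finset.prod_congr rfl fun a _ => ?_
  rw [charFun_map_mul_comp (hX a).aemeasurable, (hX a).map_eq, charFun_map_cast_poissonMeasure,
    mul_comm (c a)]

end FiniteFamily
-- Second moments as `L²` norms
section SquareNorms

variable {Ω : Type*} [MeasurableSpace Ω] {P : Measure Ω}

lemma HasExpectation.eLpNorm_two_eq {F : Ω → ℝ} {a : ℝ} (hF : AEStronglyMeasurable F P)
    (h : HasExpectation P (fun ω => F ω ^ 2) a) : eLpNorm F 2 P = ENNReal.ofReal √a := by
  rw [(memLp_two_of_hasExpectation_sq hF h).eLpNorm_eq_integral_rpow_norm two_ne_zero (by simp),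
    ← h.2]
  simp [Real.sqrt_eq_rpow]

lemma HasExpectation.congr_ae {f g : Ω → ℝ} {a : ℝ} (hf : HasExpectation P f a)
    (h : ∀ᵐ ω ∂P, g ω = f ω) : HasExpectation P g a :=
  ⟨hf.1.congr (h.mono fun _ hω => hω.symm), (integral_congr_ae h).trans hf.2⟩

/-- Fatou's lemma for second moments. -/
lemma eLpNorm_two_le_of_tendsto {F : ℕ → Ω → ℝ} {G : Ω → ℝ} {a : ℕ → ℝ} {b : ℝ}
    (hF : ∀ k, AEStronglyMeasurable (F k) P) (h : ∀ k, HasExpectation P (fun ω => F k ω ^ 2) (a k))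
    (hlim : ∀ᵐ ω ∂P, Tendsto (fun k => F k ω) atTop (𝓝 (G ω))) (ha : Tendsto a atTop (𝓝 b)) :
    eLpNorm G 2 P ≤ ENNReal.ofReal √b := by
  refine (Lp.eLpNorm_lim_le_liminf_eLpNorm hF G hlim).trans (le_of_eq ?_)
  simp_rw [(h _).eLpNorm_two_eq (hF _)]
  exact ((ENNReal.continuous_ofReal.comp Real.continuous_sqrt).continuousAt.tendsto.comp
    ha).liminf_eq

end SquareNorms

/-! ### Integrals of simple functions as finite sums -/

section SimpleFunctions

variable {E : Type*} [MeasurableSpace E]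

/-- Stated for an arbitrary measure finite on `A`, so that it applies both to the intensity and to
almost every realization `N ω`. -/
lemma setIntegral_comp_simpleFunc {F : Type*} [NormedAddCommGroup F] [NormedSpace ℝ F]
    [CompleteSpace F] {μ : Measure E} {A : Set E} (hμA : μ A < ∞)
    (g : SimpleFunc E ℝ) (φ : ℝ → F) (hφ : φ 0 = 0) :
    ∫ x in A, φ (g x) ∂μ = ∑ v : g.range, μ.real (g ⁻¹' {v.1} ∩ A) • φ v.1 := by
  have : IsFiniteMeasure (μ.restrict A) := ⟨by simpa using hμA⟩
  have h := SimpleFunc.map_integral (μ := μ.restrict A) g φ (g.integrable_of_isFiniteMeasure) hφ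
  rw [SimpleFunc.integral_eq_integral _ (SimpleFunc.integrable_of_isFiniteMeasure _)] at h
  simp only [SimpleFunc.coe_map, Function.comp] at h
  rw [h, ← Finset.sum_coe_sort]
  refine Finset.sum_congr rfl fun v _ => ?_
  rw [measureReal_restrict_apply (g.measurableSet_preimage _)]

end SimpleFunctions

/-! ### Poisson integrals: isometry bound, quadratic variation, characteristic function -/

namespace IsPoissonRandomMeasure

variable {Ω E : Type*} [MeasurableSpace Ω] [MeasurableSpace E] {P : Measure Ω}
  {N : Ω → Measure E} {m : Measure E}

lemma measurable_real (hN : IsPoissonRandomMeasure P N m) {A : Set E} (hA : MeasurableSet A) :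
    Measurable fun ω => (N ω).real A :=
  ((Measure.measurable_coe hA).comp hN.measurable).ennreal_toReal

lemma ae_lt_top (hN : IsPoissonRandomMeasure P N m) {A : Set E} (hA : MeasurableSet A)
    (hmA : m A < ∞) : ∀ᵐ ω ∂P, N ω A < ∞ := by
  have hmeas : Measurable fun ω => N ω A := (Measure.measurable_coe hA).comp hN.measurable
  have h : ∀ᵐ y ∂(P.map fun ω => N ω A), y < ∞ := by
    rw [hN.map_of_lt_top A hA hmA, ae_map_iff .of_discrete measurableSet_Iio]
    simp
  exact ae_of_ae_map hmeas.aemeasurable h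

lemma hasLaw_real (hN : IsPoissonRandomMeasure P N m) {A : Set E} (hA : MeasurableSet A)
    (hmA : m A < ∞) : HasLaw (fun ω => (N ω).real A)
      ((poissonMeasure (m A).toNNReal).map (Nat.cast : ℕ → ℝ)) P := by
  have hmeas : Measurable fun ω => N ω A := (Measure.measurable_coe hA).comp hN.measurable
  refine ⟨(hN.measurable_real hA).aemeasurable, ?_⟩
  have h := congrArg (Measure.map ENNReal.toReal) (hN.map_of_lt_top A hA hmA)
  rw [Measure.map_map ENNReal.measurable_toReal hmeas,
    Measure.map_map ENNReal.measurable_toReal .of_discrete] at h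
  exact h

/-- Padding with empty sets turns a finite disjoint family into the infinite sequence required by
the definition. -/
lemma iIndepFun_real (hN : IsPoissonRandomMeasure P N m) {J : Type*} [Fintype J] {A : J → Set E}
    (hA : ∀ a, MeasurableSet (A a)) (hd : Pairwise fun a b => Disjoint (A a) (A b)) :
    ProbabilityTheory.iIndepFun (fun a ω => (N ω).real (A a)) P := by
  let e := Fintype.equivFin J
  let B : ℕ → Set E := fun n => if h : n < Fintype.card J then A (e.symm ⟨n, h⟩) else ∅
  have hB : ∀ n, MeasurableSet (B n) := fun n => by
    by_cases h : n < Fintype.card J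
    · simpa only [B, dif_pos h] using hA _
    · simp only [B, dif_neg h, MeasurableSet.empty]
  have hBd : Pairwise fun i j => Disjoint (B i) (B j) := by
    intro i j hij
    by_cases hi : i < Fintype.card J
    · by_cases hj : j < Fintype.card J
      · simp only [B, dif_pos hi, dif_pos hj]
        refine hd fun h => hij ?_
        simpa using h
      · simp only [B, dif_neg hj, Set.disjoint_empty]
    · simp only [B, dif_neg hi, Set.empty_disjoint]
  have h := (hN.iIndepFun B hB hBd).precomp (g := fun a : J => (e a : ℕ))
    (fun a b hab => e.injective (Fin.ext hab))
  have h2 := h.comp (fun _ x => ENNReal.toReal x) (fun _ => ENNReal.measurable_toReal)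
  convert! h2 using 3 with a ω
  simp [B, Measure.real]

variable [IsProbabilityMeasure P]

/-- The moment identities for compensated integrals of simple functions over disjoint sets. -/
lemma hasExpectation_simpleFunc (hN : IsPoissonRandomMeasure P N m) {ι : Type*} [Fintype ι]
    {A : ι → Set E} (hA : ∀ i, MeasurableSet (A i)) (hmA : ∀ i, m (A i) < ∞)
    (hd : Pairwise fun i j => Disjoint (A i) (A j)) (g : SimpleFunc E ℝ) :
    (∀ i, HasExpectation P (fun ω => (∫ x in A i, g x ∂(N ω) - ∫ x in A i, g x ∂m) ^ 2)
      (∫ x in A i, g x ^ 2 ∂m)) ∧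
    HasExpectation P (fun ω => (∑ i, ((∫ x in A i, g x ∂(N ω) - ∫ x in A i, g x ∂m) ^ 2
      - ∫ x in A i, g x ^ 2 ∂(N ω))) ^ 2) (2 * ∑ i, (∫ x in A i, g x ^ 2 ∂m) ^ 2) := by
  classical
  -- The pieces on which `g` is constant have independent Poisson counts; grouping them by `i`
  -- reduces the claim to a finite family.
  let B : ι × g.range → Set E := fun a => g ⁻¹' {a.2.1} ∩ A a.1
  have hB : ∀ a, MeasurableSet (B a) := fun a => (g.measurableSet_preimage _).inter (hA _)
  have hmB : ∀ a, m (B a) < ∞ := fun a =>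
    (measure_mono Set.inter_subset_right).trans_lt (hmA a.1)
  have hBd : Pairwise fun a b => Disjoint (B a) (B b) := by
    intro a b hab
    by_cases h : a.1 = b.1
    · have h2 : a.2.1 ≠ b.2.1 := fun h2 => hab (Prod.ext h (Subtype.ext h2))
      refine Disjoint.mono Set.inter_subset_left Set.inter_subset_left ?_
      exact Disjoint.preimage _ (by simpa using h2)
    · exact Disjoint.mono Set.inter_subset_right Set.inter_subset_right (hd h)
  obtain ⟨h1, -, h3⟩ := hasExpectation_sum_sq_sub_quadVar (fun a => hN.hasLaw_real (hB a) (hmB a))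
    (fun a => hN.measurable_real (hB a)) (hN.iIndepFun_real hB hBd)
    (fun a => a.2.1) (fun a : ι × g.range => a.1) Finset.univ
  have hr : ∀ a, ((m (B a)).toNNReal : ℝ) = m.real (B a) := fun a => rfl
  have hsum : ∀ (i : ι) (G : ι × g.range → ℝ), (∑ a, if a.1 = i then G a else 0) =
      ∑ v, G (i, v) := fun i G => by
    rw [Fintype.sum_prod_type, Finset.sum_eq_single i (fun j _ hj => by simp [hj]) (by simp)]
    simp
  have hlin : ∀ {μ : Measure E} (i : ι), μ (A i) < ∞ →
      ∫ x in A i, g x ∂μ = ∑ v : g.range, v.1 * μ.real (B (i, v)) := fun i h => by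
    simpa [mul_comm, B] using setIntegral_comp_simpleFunc h g id rfl
  have hquad : ∀ {μ : Measure E} (i : ι), μ (A i) < ∞ →
      ∫ x in A i, g x ^ 2 ∂μ = ∑ v : g.range, v.1 ^ 2 * μ.real (B (i, v)) := fun i h => by
    simpa [mul_comm, B] using setIntegral_comp_simpleFunc h g (fun x => x ^ 2) (by simp)
  have hfin : ∀ᵐ ω ∂P, ∀ i, N ω (A i) < ∞ := ae_all_iff.2 fun i => hN.ae_lt_top (hA i) (hmA i)
  simp only [hr, hsum] at h1 h3
  constructor
  · intro i
    rw [hquad i (hmA i)]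
    refine (h1 i).2.congr_ae (hfin.mono fun ω hω => ?_)
    rw [hlin i (hω i), hlin i (hmA i), ← Finset.sum_sub_distrib]
    simp only [mul_sub]
  · simp only [hquad _ (hmA _)]
    refine h3.congr_ae (hfin.mono fun ω hω => ?_)
    rw [Finset.sum_sub_distrib, Fintype.sum_prod_type]
    simp only [hlin _ (hω _), hlin _ (hmA _), hquad _ (hω _), ← Finset.sum_sub_distrib, mul_sub]

omit [IsProbabilityMeasure P] in
lemma charFun_simpleFunc (hN : IsPoissonRandomMeasure P N m) {A : Set E} (hA : MeasurableSet A)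
    (hmA : m A < ∞) (g : SimpleFunc E ℝ) (t : ℝ) :
    charFun (P.map fun ω => ∫ x in A, g x ∂(N ω)) t =
      Complex.exp (∫ x in A, (Complex.exp ((t * g x : ℝ) * Complex.I) - 1) ∂m) := by
  classical
  let B : g.range → Set E := fun v => g ⁻¹' {v.1} ∩ A
  have hB : ∀ v, MeasurableSet (B v) := fun v => (g.measurableSet_preimage _).inter hA
  have hmB : ∀ v, m (B v) < ∞ := fun v => (measure_mono Set.inter_subset_right).trans_lt hmA
  have hBd : Pairwise fun a b => Disjoint (B a) (B b) := fun a b hab =>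
    Disjoint.mono Set.inter_subset_left Set.inter_subset_left
      (Disjoint.preimage _ (Set.disjoint_singleton.2 fun h => hab (Subtype.ext h)))
  have h := charFun_sum_poisson (fun v => hN.hasLaw_real (hB v) (hmB v)) (hN.iIndepFun_real hB hBd)
    (fun v => v.1) t
  rw [setIntegral_comp_simpleFunc hmA g (fun x => Complex.exp ((t * x : ℝ) * Complex.I) - 1)
    (by simp)]
  have hae : (fun ω => ∫ x in A, g x ∂(N ω)) =ᵐ[P] fun ω => ∑ v : g.range, v.1 * (N ω).real (B v) :=
    (hN.ae_lt_top hA hmA).mono fun ω hω => by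
      simpa [mul_comm, B] using setIntegral_comp_simpleFunc hω g id rfl
  rw [Measure.map_congr hae, h]
  congr 1

/-- Bounded pointwise approximation by simple functions passes to integrals over sets of finite
measure. -/
lemma _root_.tendsto_setIntegral_comp_approxBounded {F : Type*} [NormedAddCommGroup F]
    [NormedSpace ℝ F] {μ : Measure E} {A : Set E} (hμA : μ A < ∞) {f : E → ℝ}
    (hf : StronglyMeasurable f) {C : ℝ} (hC : ∀ x, |f x| ≤ C) {φ : ℝ → F} (hφ : Continuous φ) :
    Tendsto (fun k => ∫ x in A, φ (hf.approxBounded C k x) ∂μ) atTop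
      (𝓝 (∫ x in A, φ (f x) ∂μ)) := by
  have : IsFiniteMeasure (μ.restrict A) := ⟨by simpa using hμA⟩
  obtain ⟨D, hD⟩ := (isCompact_Icc (a := -C) (b := C)).exists_bound_of_continuousOn hφ.continuousOn
  by_cases hA : Nonempty E
  · have hC0 : 0 ≤ C := (abs_nonneg _).trans (hC hA.some)
    refine tendsto_integral_of_dominated_convergence (fun _ => D)
      (fun k => hφ.comp_aestronglyMeasurable
        (hf.approxBounded C k).stronglyMeasurable.aestronglyMeasurable)
      (integrable_const _) (fun k => ae_of_all _ fun x => hD _ ?_) (ae_of_all _ fun x => ?_)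
    · exact abs_le.1 (hf.norm_approxBounded_le hC0 k x)
    · exact (hφ.tendsto _).comp (hf.tendsto_approxBounded_of_norm_le (hC x))
  · have : IsEmpty E := not_nonempty_iff.1 hA
    have h0 : μ.restrict A = 0 := Measure.eq_zero_of_isEmpty _
    simp [h0]

section Bounded

variable {f : E → ℝ} {C : ℝ}

omit [IsProbabilityMeasure P] in
lemma measurable_setIntegral_simpleFunc (hN : IsPoissonRandomMeasure P N m) {A : Set E}
    (hA : MeasurableSet A) (hmA : m A < ∞) (g : SimpleFunc E ℝ) :
    AEStronglyMeasurable (fun ω => ∫ x in A, g x ∂(N ω)) P := by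
  have hm : Measurable fun ω => ∑ v : g.range, (N ω).real (g ⁻¹' {v.1} ∩ A) * v.1 :=
    Finset.measurable_sum _ fun v _ =>
      (hN.measurable_real ((g.measurableSet_preimage _).inter hA)).mul_const _
  refine hm.aestronglyMeasurable.congr ?_
  filter_upwards [hN.ae_lt_top hA hmA] with ω hω
  simpa using (setIntegral_comp_simpleFunc hω g id rfl).symm

omit [IsProbabilityMeasure P] in
lemma ae_tendsto_approxBounded (hN : IsPoissonRandomMeasure P N m) {A : Set E}
    (hA : MeasurableSet A) (hmA : m A < ∞) (hf : StronglyMeasurable f) (hC : ∀ x, |f x| ≤ C)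
    {φ : ℝ → ℝ} (hφ : Continuous φ) :
    ∀ᵐ ω ∂P, Tendsto (fun k => ∫ x in A, φ (hf.approxBounded C k x) ∂(N ω)) atTop
      (𝓝 (∫ x in A, φ (f x) ∂(N ω))) :=
  (hN.ae_lt_top hA hmA).mono fun _ hω => tendsto_setIntegral_comp_approxBounded hω hf hC hφ

omit [IsProbabilityMeasure P] in
lemma aestronglyMeasurable_setIntegral (hN : IsPoissonRandomMeasure P N m) {A : Set E}
    (hA : MeasurableSet A) (hmA : m A < ∞) (hf : Measurable f) (hC : ∀ x, |f x| ≤ C) :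
    AEStronglyMeasurable (fun ω => ∫ x in A, f x ∂(N ω)) P :=
  aestronglyMeasurable_of_tendsto_ae atTop
    (fun k => hN.measurable_setIntegral_simpleFunc hA hmA (hf.stronglyMeasurable.approxBounded C k))
    (hN.ae_tendsto_approxBounded hA hmA hf.stronglyMeasurable hC continuous_id)

/-- The (one-sided) isometry for compensated Poisson integrals. -/
lemma eLpNorm_compensated_le (hN : IsPoissonRandomMeasure P N m) {A : Set E}
    (hA : MeasurableSet A) (hmA : m A < ∞) (hf : Measurable f) (hC : ∀ x, |f x| ≤ C) :
    eLpNorm (fun ω => ∫ x in A, f x ∂(N ω) - ∫ x in A, f x ∂m) 2 P ≤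
      ENNReal.ofReal √(∫ x in A, f x ^ 2 ∂m) := by
  have hs := hf.stronglyMeasurable
  -- Fatou's lemma turns the equality for simple approximations into an inequality, which suffices
  -- for error estimates.
  refine eLpNorm_two_le_of_tendsto
    (F := fun k ω => ∫ x in A, hs.approxBounded C k x ∂(N ω) - ∫ x in A, hs.approxBounded C k x ∂m)
    (a := fun k => ∫ x in A, hs.approxBounded C k x ^ 2 ∂m) (fun k => ?_) (fun k => ?_) ?_
    (tendsto_setIntegral_comp_approxBounded hmA hs hC (continuous_pow 2))
  · exact (hN.measurable_setIntegral_simpleFunc hA hmA _).sub aestronglyMeasurable_const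
  · exact (hN.hasExpectation_simpleFunc (ι := Unit) (A := fun _ => A) (fun _ => hA) (fun _ => hmA)
      (fun i j h => (h rfl).elim) _).1 ()
  · filter_upwards [hN.ae_tendsto_approxBounded hA hmA hs hC continuous_id] with ω hω
    exact hω.sub (tendsto_setIntegral_comp_approxBounded hmA hs hC continuous_id)

/-- The sum of squares of compensated Poisson integrals over disjoint sets is close to the
quadratic variation. -/
lemma eLpNorm_sum_sq_sub_quadVar_le (hN : IsPoissonRandomMeasure P N m) {ι : Type*} [Fintype ι]
    {A : ι → Set E} (hA : ∀ i, MeasurableSet (A i)) (hmA : ∀ i, m (A i) < ∞)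
    (hd : Pairwise fun i j => Disjoint (A i) (A j)) (hf : Measurable f) (hC : ∀ x, |f x| ≤ C) :
    eLpNorm (fun ω => ∑ i, ((∫ x in A i, f x ∂(N ω) - ∫ x in A i, f x ∂m) ^ 2
      - ∫ x in A i, f x ^ 2 ∂(N ω))) 2 P ≤
      ENNReal.ofReal √(2 * ∑ i, (∫ x in A i, f x ^ 2 ∂m) ^ 2) := by
  have hs := hf.stronglyMeasurable
  refine eLpNorm_two_le_of_tendsto
    (F := fun k ω => ∑ i, ((∫ x in A i, hs.approxBounded C k x ∂(N ω)
      - ∫ x in A i, hs.approxBounded C k x ∂m) ^ 2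
      - ∫ x in A i, hs.approxBounded C k x ^ 2 ∂(N ω)))
    (a := fun k => 2 * ∑ i, (∫ x in A i, hs.approxBounded C k x ^ 2 ∂m) ^ 2)
    (fun k => ?_) (fun k => ?_) ?_ ?_
  · refine Finset.aestronglyMeasurable_fun_sum _ fun i _ => ?_
    refine (((hN.measurable_setIntegral_simpleFunc (hA i) (hmA i) _).sub
      aestronglyMeasurable_const).pow 2).sub ?_
    exact hN.measurable_setIntegral_simpleFunc (hA i) (hmA i)
      ((hs.approxBounded C k).map fun x => x ^ 2)
  · exact (hN.hasExpectation_simpleFunc hA hmA hd _).2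
  · have h1 := ae_all_iff.2 fun i =>
      hN.ae_tendsto_approxBounded (hA i) (hmA i) hs hC continuous_id
    have h2 := ae_all_iff.2 fun i =>
      hN.ae_tendsto_approxBounded (hA i) (hmA i) hs hC (continuous_pow 2)
    filter_upwards [h1, h2] with ω hω1 hω2
    exact tendsto_finsetSum _ fun i _ => (((hω1 i).sub
      (tendsto_setIntegral_comp_approxBounded (hmA i) hs hC continuous_id)).pow 2).sub (hω2 i)
  · exact (tendsto_finsetSum _ fun i _ =>
      (tendsto_setIntegral_comp_approxBounded (hmA i) hs hC (continuous_pow 2)).pow 2).const_mul 2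

/-- Both sides of the identity for simple functions converge along bounded approximations: the left
one by domination by `1`, the right one by finiteness of `m A`. -/
lemma charFun_setIntegral (hN : IsPoissonRandomMeasure P N m) {A : Set E} (hA : MeasurableSet A)
    (hmA : m A < ∞) (hf : Measurable f) (hC : ∀ x, |f x| ≤ C) (t : ℝ) :
    charFun (P.map fun ω => ∫ x in A, f x ∂(N ω)) t =
      Complex.exp (∫ x in A, (Complex.exp ((t * f x : ℝ) * Complex.I) - 1) ∂m) := by
  have hs := hf.stronglyMeasurable
  have hφ : Continuous fun x : ℝ => Complex.exp ((t * x : ℝ) * Complex.I) - 1 := by fun_prop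
  have h1 := (Complex.continuous_exp.tendsto _).comp
    (tendsto_setIntegral_comp_approxBounded hmA hs hC hφ)
  refine tendsto_nhds_unique (f := fun k => charFun (P.map fun ω =>
    ∫ x in A, hs.approxBounded C k x ∂(N ω)) t) (l := atTop) ?_ ?_
  · have hc : ∀ {X : Ω → ℝ}, AEStronglyMeasurable X P →
        charFun (P.map X) t = ∫ ω, Complex.exp (t * X ω * Complex.I) ∂P := fun hX => by
      rw [charFun_apply_real, integral_map hX.aemeasurable (by fun_prop)]
    simp_rw [hc (hN.measurable_setIntegral_simpleFunc hA hmA _)]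
    rw [hc (hN.aestronglyMeasurable_setIntegral hA hmA hf hC)]
    refine tendsto_integral_of_dominated_convergence (fun _ => 1) (fun k => ?_)
      (integrable_const _) (fun k => ae_of_all _ fun ω => ?_) ?_
    · have := hN.measurable_setIntegral_simpleFunc hA hmA (hs.approxBounded C k)
      have hcont : Continuous fun x : ℝ => Complex.exp (t * x * Complex.I) := by fun_prop
      exact hcont.comp_aestronglyMeasurable this
    · rw [← Complex.ofReal_mul, Complex.norm_exp_ofReal_mul_I]
    · filter_upwards [hN.ae_tendsto_approxBounded hA hmA hs hC continuous_id] with ω hω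
      have hcont : Continuous fun x : ℝ => Complex.exp (t * x * Complex.I) := by fun_prop
      exact (hcont.tendsto _).comp hω
  · refine h1.congr fun k => ?_
    exact (hN.charFun_simpleFunc hA hmA _ t).symm

end Bounded

end IsPoissonRandomMeasure
-- Moments of a Lévy measure near the origin
lemma measurableSet_jumpShell (a b : ℝ) : MeasurableSet (jumpShell a b) :=
  (measurableSet_lt measurable_const measurable_abs).inter
    (measurableSet_le measurable_abs measurable_const)

lemma measurableSet_abs_le (ε : ℝ) : MeasurableSet {x : ℝ | |x| ≤ ε} :=
  measurableSet_le measurable_abs measurable_const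

lemma smallMoment_nonneg (ν : Measure ℝ) {j : ℕ} (hj : Even j) (ε : ℝ) :
    0 ≤ smallMoment ν j ε :=
  integral_nonneg fun _ => hj.pow_nonneg _

namespace IsLevyMeasure

variable {ν : Measure ℝ}

lemma integrable_min (hν : IsLevyMeasure ν) : Integrable (fun x : ℝ => min 1 (x ^ 2)) ν := by
  refine ⟨by fun_prop, ?_⟩
  rw [hasFiniteIntegral_iff_ofReal (ae_of_all _ fun x => by positivity)]
  exact hν.lintegral_lt_top

lemma integrableOn_of_le (hν : IsLevyMeasure ν) {F : Type*} [NormedAddCommGroup F] {f : ℝ → F}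
    {A : Set ℝ} (hA : MeasurableSet A) (hf : AEStronglyMeasurable f ν) (K : ℝ)
    (h : ∀ x ∈ A, ‖f x‖ ≤ K * min 1 (x ^ 2)) : IntegrableOn f A ν := by
  refine Integrable.mono' (hν.integrable_min.const_mul K).integrableOn hf.restrict ?_
  exact (ae_restrict_iff' hA).2 (ae_of_all _ h)

/-- The exponent `j + 2` records that two powers of `x` are spent on the Lévy condition. The
constant covers `|x| ≥ 1` too, where the minimum is `1` and `x² ≤ ε²`. -/
lemma integrableOn_pow (hν : IsLevyMeasure ν) (j : ℕ) (ε : ℝ) :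
    IntegrableOn (fun x : ℝ => x ^ (j + 2)) {x | |x| ≤ ε} ν := by
  refine hν.integrableOn_of_le (measurableSet_abs_le ε) (by fun_prop) (ε ^ j * (1 + ε ^ 2)) ?_
  intro x hx
  have hx' : |x| ≤ ε := hx
  have h0 : 0 ≤ ε := (abs_nonneg _).trans hx'
  rw [norm_pow, Real.norm_eq_abs, pow_add, mul_assoc]
  refine mul_le_mul (pow_le_pow_left₀ (abs_nonneg _) hx' _) ?_ (by positivity) (by positivity)
  have h2 : |x| ^ 2 ≤ ε ^ 2 := pow_le_pow_left₀ (abs_nonneg _) hx' _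
  rw [sq_abs] at *
  rcases le_total 1 (x ^ 2) with h | h
  · rw [min_eq_left h]; linarith
  · rw [min_eq_right h]; nlinarith [sq_nonneg x, sq_nonneg ε]

lemma measure_lt_abs_lt_top (hν : IsLevyMeasure ν) {a : ℝ} (ha : 0 < a) :
    ν {x | a < |x|} < ∞ := by
  have hA : MeasurableSet {x : ℝ | a < |x|} := measurableSet_lt measurable_const measurable_abs
  have h : IntegrableOn (fun _ : ℝ => (1 : ℝ)) {x : ℝ | a < |x|} ν := by
    refine hν.integrableOn_of_le hA (by fun_prop) (1 + 1 / a ^ 2) ?_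
    intro x hx
    have hx2 : a ^ 2 ≤ x ^ 2 := by
      rw [← sq_abs x]
      exact pow_le_pow_left₀ ha.le (le_of_lt hx) _
    have ha2 : 0 < a ^ 2 := by positivity
    rw [norm_one]
    rcases le_total 1 (x ^ 2) with h | h
    · rw [min_eq_left h, mul_one]
      have : 0 ≤ 1 / a ^ 2 := by positivity
      linarith
    · rw [min_eq_right h, add_mul, div_mul_eq_mul_div, one_mul]
      have : 1 ≤ x ^ 2 / a ^ 2 := (one_le_div ha2).2 hx2
      have := sq_nonneg x
      linarith
  simpa [integrableOn_const_iff] using h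

lemma measure_jumpShell_lt_top (hν : IsLevyMeasure ν) {a : ℝ} (ha : 0 < a) (b : ℝ) :
    ν (jumpShell a b) < ∞ :=
  (measure_mono fun _ hx => hx.1).trans_lt (hν.measure_lt_abs_lt_top ha)

lemma sigmaFinite (hν : IsLevyMeasure ν) : SigmaFinite ν := by
  refine ⟨⟨⟨fun n => {0} ∪ {x | 1 / ((n : ℝ) + 1) < |x|}, fun _ => trivial, fun n => ?_, ?_⟩⟩⟩
  · refine (measure_union_le _ _).trans_lt ?_
    rw [hν.zero, zero_add]
    exact hν.measure_lt_abs_lt_top (by positivity)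
  · refine Set.eq_univ_of_forall fun x => ?_
    rw [Set.mem_iUnion]
    by_cases hx : x = 0
    · exact ⟨0, Or.inl hx⟩
    · obtain ⟨n, hn⟩ := exists_nat_one_div_lt (abs_pos.2 hx)
      exact ⟨n, Or.inr hn⟩

lemma smallMoment_sub (hν : IsLevyMeasure ν) (j : ℕ) {δ ε : ℝ} (h : δ ≤ ε) :
    smallMoment ν (j + 2) ε - smallMoment ν (j + 2) δ = ∫ x in jumpShell δ ε, x ^ (j + 2) ∂ν := by
  have hU : {x : ℝ | |x| ≤ ε} = {x : ℝ | |x| ≤ δ} ∪ jumpShell δ ε := by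
    ext x
    simp only [jumpShell, Set.mem_union, Set.mem_ofPred_eq]
    constructor
    · intro hx
      rcases le_or_gt |x| δ with h' | h'
      · exact Or.inl h'
      · exact Or.inr ⟨h', hx⟩
    · rintro (hx | hx)
      · exact hx.trans h
      · exact hx.2
  have hd : Disjoint {x : ℝ | |x| ≤ δ} (jumpShell δ ε) :=
    Set.disjoint_left.2 fun x hx hx' => not_lt.2 hx hx'.1
  have hi := hν.integrableOn_pow j ε
  unfold smallMoment
  rw [hU] at hi ⊢
  rw [setIntegral_union hd (measurableSet_jumpShell _ _) hi.left_of_union hi.right_of_union]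
  ring

lemma smallMoment_mono (hν : IsLevyMeasure ν) {j : ℕ} (hj : Even j) {δ ε : ℝ} (h : δ ≤ ε) :
    smallMoment ν (j + 2) δ ≤ smallMoment ν (j + 2) ε := by
  have h1 := hν.smallMoment_sub j h
  have h2 : 0 ≤ ∫ x in jumpShell δ ε, x ^ (j + 2) ∂ν :=
    integral_nonneg fun _ => (hj.add even_two).pow_nonneg _
  linarith

lemma smallMoment_add_two_le (hν : IsLevyMeasure ν) {j : ℕ} (hj : Even j) (ε : ℝ) :
    smallMoment ν (j + 2 + 2) ε ≤ ε ^ 2 * smallMoment ν (j + 2) ε := by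
  unfold smallMoment
  rw [← integral_const_mul]
  refine setIntegral_mono_on (hν.integrableOn_pow (j + 2) ε)
    ((hν.integrableOn_pow j ε).const_mul _) (measurableSet_abs_le ε) fun x hx => ?_
  rw [pow_add, mul_comm]
  have : x ^ 2 ≤ ε ^ 2 := by
    rw [← sq_abs x]
    exact pow_le_pow_left₀ (abs_nonneg _) hx _
  exact mul_le_mul_of_nonneg_right this ((hj.add even_two).pow_nonneg _)

/-- Dominated convergence under `min 1 (x²)`: the sets shrink to `{0}`, where the integrand
vanishes. -/
lemma tendsto_smallMoment_two (hν : IsLevyMeasure ν) :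
    Tendsto (smallMoment ν 2) (𝓝[>] 0) (𝓝 0) := by
  have h : Tendsto (fun ε : ℝ => ∫ x, ({x : ℝ | |x| ≤ ε}).indicator (fun x => x ^ 2) x ∂ν) (𝓝[>] 0)
      (𝓝 (∫ _, (0 : ℝ) ∂ν)) := by
    refine tendsto_integral_filter_of_dominated_convergence (fun x => min 1 (x ^ 2)) ?_ ?_
      hν.integrable_min ?_
    · exact Eventually.of_forall fun ε => Measurable.aestronglyMeasurable
        ((measurable_id.pow_const 2).indicator (measurableSet_abs_le ε))
    · filter_upwards [Ioc_mem_nhdsGT (zero_lt_one' ℝ)] with ε hε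
      refine ae_of_all _ fun x => ?_
      by_cases hx : |x| ≤ ε
      · rw [Set.indicator_of_mem (by exact hx), norm_pow, Real.norm_eq_abs, sq_abs, le_min_iff]
        exact ⟨by rw [sq_le_one_iff_abs_le_one]; exact hx.trans hε.2, le_rfl⟩
      · rw [Set.indicator_of_notMem (by exact hx), norm_zero]
        positivity
    · refine ae_of_all _ fun x => ?_
      by_cases hx : x = 0
      · subst hx
        refine tendsto_const_nhds.congr fun ε => ?_
        by_cases h : (0 : ℝ) ∈ {x : ℝ | |x| ≤ ε}
        · rw [Set.indicator_of_mem h]; simp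
        · rw [Set.indicator_of_notMem h]
      · refine tendsto_const_nhds.congr' ?_
        filter_upwards [Ioo_mem_nhdsGT (abs_pos.2 hx)] with ε hε
        rw [Set.indicator_of_notMem]
        exact not_le.2 hε.2
  simp only [integral_indicator (measurableSet_abs_le _), integral_zero] at h
  exact h

end IsLevyMeasure

/-! ### The product intensity on time strips -/

section Intensity

variable {ν : Measure ℝ} {T s t : ℝ}

lemma restrict_prod_Ioc [SFinite ν] (hs : 0 ≤ s) (ht : t ≤ T) (B : Set ℝ) :
    ((volume.restrict (Set.Icc 0 T)).prod ν).restrict (Set.Ioc s t ×ˢ B) =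
      (volume.restrict (Set.Ioc s t)).prod (ν.restrict B) := by
  rw [← Measure.prod_restrict, Measure.restrict_restrict measurableSet_Ioc,
    Set.inter_eq_left.2 (Set.Ioc_subset_Icc_self.trans (Set.Icc_subset_Icc hs ht))]

lemma measure_prod_Ioc_lt_top [SFinite ν] (hs : 0 ≤ s) (ht : t ≤ T) {B : Set ℝ} (hB : ν B < ∞) :
    ((volume.restrict (Set.Icc 0 T)).prod ν) (Set.Ioc s t ×ˢ B) < ∞ := by
  rw [← Measure.restrict_apply_univ, restrict_prod_Ioc hs ht, ← Set.univ_prod_univ,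
    Measure.prod_prod]
  simpa using ENNReal.mul_lt_top ENNReal.ofReal_lt_top hB

lemma setIntegral_prod_Ioc [SFinite ν] {F : Type*} [NormedAddCommGroup F] [NormedSpace ℝ F]
    (hs : 0 ≤ s) (hst : s ≤ t) (ht : t ≤ T) (B : Set ℝ) (f : ℝ → F) :
    ∫ z in Set.Ioc s t ×ˢ B, f z.2 ∂((volume.restrict (Set.Icc 0 T)).prod ν) =
      (t - s) • ∫ x in B, f x ∂ν := by
  rw [restrict_prod_Ioc hs ht, integral_fun_snd]
  simp [Measure.real, hst]

end Intensity

/-- The truncation of `x` to `[-ε, ε]`. -/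
def truncate (ε x : ℝ) : ℝ := max (-ε) (min ε x)

lemma measurable_truncate (ε : ℝ) : Measurable (truncate ε) := by
  unfold truncate; fun_prop

lemma abs_truncate_le {ε : ℝ} (hε : 0 ≤ ε) (x : ℝ) : |truncate ε x| ≤ ε := by
  unfold truncate
  exact abs_le.2 ⟨le_max_left _ _, max_le (by linarith) (min_le_left _ _)⟩

lemma truncate_of_abs_le {ε x : ℝ} (hx : |x| ≤ ε) : truncate ε x = x := by
  unfold truncate
  rw [min_eq_right (abs_le.1 hx).2, max_eq_right (abs_le.1 hx).1]

/-- Truncation is invisible on the shell but makes the integrand bounded everywhere, as the Poisson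
integral lemmas require. -/
lemma setIntegral_truncate {F : Type*} [NormedAddCommGroup F] [NormedSpace ℝ F] (μ : Measure (ℝ × ℝ))
    (s t δ ε : ℝ) (φ : ℝ → F) :
    ∫ z in Set.Ioc s t ×ˢ jumpShell δ ε, φ (truncate ε z.2) ∂μ =
      ∫ z in Set.Ioc s t ×ˢ jumpShell δ ε, φ z.2 ∂μ :=
  setIntegral_congr_fun (measurableSet_Ioc.prod (measurableSet_jumpShell _ _))
    fun z hz => by simp only [truncate_of_abs_le hz.2.2]

/-! ### Existence of the compensated small-jump integral -/

section SmallJumps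

variable {Ω : Type*} [MeasurableSpace Ω] {P : Measure Ω} {ν : Measure ℝ}
  {T s t : ℝ} {N : Ω → Measure (ℝ × ℝ)}

omit [MeasurableSpace Ω] in
lemma compShell_eq [SFinite ν] (hs : 0 ≤ s) (hst : s ≤ t) (ht : t ≤ T) (ε δ : ℝ) (ω : Ω) :
    compShell N ν s t ε δ ω =
      ∫ z in Set.Ioc s t ×ˢ jumpShell δ ε, truncate ε z.2 ∂(N ω) -
      ∫ z in Set.Ioc s t ×ˢ jumpShell δ ε, truncate ε z.2
        ∂((volume.restrict (Set.Icc 0 T)).prod ν) := by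
  rw [setIntegral_truncate _ _ _ _ _ (fun x => x), setIntegral_truncate _ _ _ _ _ (fun x => x),
    setIntegral_prod_Ioc hs hst ht _ (fun x => x)]
  rfl

variable (hν : IsLevyMeasure ν)
  (hN : IsPoissonRandomMeasure P N ((volume.restrict (Set.Icc 0 T)).prod ν))
include hν hN

lemma aestronglyMeasurable_compShell (hs : 0 ≤ s) (hst : s ≤ t) (ht : t ≤ T) {ε δ : ℝ}
    (hε : 0 ≤ ε) (hδ : 0 < δ) : AEStronglyMeasurable (compShell N ν s t ε δ) P := by
  have := hν.sigmaFinite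
  have h : compShell N ν s t ε δ = _ := funext fun ω => compShell_eq hs hst ht ε δ ω
  rw [h]
  exact (hN.aestronglyMeasurable_setIntegral
    (measurableSet_Ioc.prod (measurableSet_jumpShell _ _))
    (measure_prod_Ioc_lt_top hs ht (hν.measure_jumpShell_lt_top hδ ε))
    ((measurable_truncate ε).comp measurable_snd) (fun z => abs_truncate_le hε z.2)).sub
    aestronglyMeasurable_const

lemma eLpNorm_compShell_le [IsProbabilityMeasure P] (hs : 0 ≤ s) (hst : s ≤ t) (ht : t ≤ T)
    {ε δ : ℝ} (hε : 0 ≤ ε) (hδ : 0 < δ) :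
    eLpNorm (compShell N ν s t ε δ) 2 P ≤
      ENNReal.ofReal √((t - s) * smallMoment ν 2 ε) := by
  have := hν.sigmaFinite
  have h : compShell N ν s t ε δ = _ := funext fun ω => compShell_eq hs hst ht ε δ ω
  rw [h]
  refine (hN.eLpNorm_compensated_le (measurableSet_Ioc.prod (measurableSet_jumpShell _ _))
    (measure_prod_Ioc_lt_top hs ht (hν.measure_jumpShell_lt_top hδ ε))
    ((measurable_truncate ε).comp measurable_snd) (fun z => abs_truncate_le hε z.2)).trans ?_
  refine ENNReal.ofReal_le_ofReal (Real.sqrt_le_sqrt ?_)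
  simp only [Function.comp]
  rw [setIntegral_truncate _ _ _ _ _ (fun x => x ^ 2),
    setIntegral_prod_Ioc hs hst ht _ (fun x => x ^ 2), smul_eq_mul]
  refine mul_le_mul_of_nonneg_left ?_ (by linarith)
  exact setIntegral_mono_set (hν.integrableOn_pow 0 ε) (ae_of_all _ fun x => sq_nonneg x)
    (ae_of_all _ fun x hx => hx.2)

lemma integrableOn_snd_jumpShell (hs : 0 ≤ s) (ht : t ≤ T) {ε δ : ℝ} (hδ : 0 < δ) (j : ℕ) :
    ∀ᵐ ω ∂P, IntegrableOn (fun z : ℝ × ℝ => z.2 ^ j) (Set.Ioc s t ×ˢ jumpShell δ ε) (N ω) := by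
  have := hν.sigmaFinite
  have hA := measurableSet_Ioc.prod (measurableSet_jumpShell δ ε) (s := Set.Ioc s t)
  filter_upwards [hN.ae_lt_top hA
    (measure_prod_Ioc_lt_top hs ht (hν.measure_jumpShell_lt_top hδ ε))] with ω hω
  refine Measure.integrableOn_of_bounded (M := |ε| ^ j) hω.ne (by fun_prop) ?_
  refine (ae_restrict_iff' hA).2 (ae_of_all _ fun z hz => ?_)
  rw [norm_pow]
  exact pow_le_pow_left₀ (norm_nonneg _) (hz.2.2.trans (le_abs_self _)) _

/-- Shells are additive. The `min` covers `δ' > ε`, when the shell from `δ'` to `ε` is empty. -/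
lemma compShell_sub (hs : 0 ≤ s) (ht : t ≤ T) {ε δ δ' : ℝ}
    (hδ : 0 < δ) (hδδ' : δ ≤ δ') : ∀ᵐ ω ∂P, compShell N ν s t ε δ ω - compShell N ν s t ε δ' ω =
      compShell N ν s t (min ε δ') δ ω := by
  have hδ' : 0 < δ' := hδ.trans_le hδδ'
  have hU : jumpShell δ ε = jumpShell δ (min ε δ') ∪ jumpShell δ' ε := by
    ext x
    simp only [jumpShell, Set.mem_union, Set.mem_ofPred_eq, le_min_iff]
    constructor
    · rintro ⟨h1, h2⟩
      rcases le_or_gt |x| δ' with h | h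
      · exact Or.inl ⟨h1, h2, h⟩
      · exact Or.inr ⟨h, h2⟩
    · rintro (h | h)
      · exact ⟨h.1, h.2.1⟩
      · exact ⟨hδδ'.trans_lt h.1, h.2⟩
  have hd : Disjoint (jumpShell δ (min ε δ')) (jumpShell δ' ε) :=
    Set.disjoint_left.2 fun x hx hx' => not_lt.2 (hx.2.trans (min_le_right _ _)) hx'.1
  have hν1 : ∀ {a b : ℝ}, 0 < a → IntegrableOn (fun x : ℝ => x) (jumpShell a b) ν := by
    intro a b ha
    refine Measure.integrableOn_of_bounded (M := |b|) (hν.measure_jumpShell_lt_top ha b).ne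
      (by fun_prop) ?_
    exact (ae_restrict_iff' (measurableSet_jumpShell _ _)).2
      (ae_of_all _ fun z hz => hz.2.trans (le_abs_self _))
  filter_upwards [integrableOn_snd_jumpShell hν hN hs ht (ε := min ε δ') hδ 1,
    integrableOn_snd_jumpShell hν hN hs ht (ε := ε) hδ' 1] with ω h1 h2
  simp only [pow_one] at h1 h2
  unfold compShell
  rw [hU, Set.prod_union, setIntegral_union (Set.disjoint_prod.2 (Or.inr hd))
    (measurableSet_Ioc.prod (measurableSet_jumpShell _ _)) h1 h2,
    setIntegral_union hd (measurableSet_jumpShell _ _) (hν1 hδ) (hν1 hδ')]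
  ring

lemma eLpNorm_compShell_sub_le [IsProbabilityMeasure P] (hs : 0 ≤ s) (hst : s ≤ t) (ht : t ≤ T)
    {ε δ δ' η : ℝ} (hε : 0 ≤ ε) (hδ : 0 < δ) (hδ' : 0 < δ') (h1 : δ ≤ η) (h2 : δ' ≤ η) :
    eLpNorm (compShell N ν s t ε δ - compShell N ν s t ε δ') 2 P ≤
      ENNReal.ofReal √((t - s) * smallMoment ν 2 η) := by
  wlog h : δ ≤ δ' generalizing δ δ'
  · rw [← eLpNorm_neg, neg_sub]
    exact this hδ' hδ h2 h1 (le_of_not_ge h)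
  have hae : compShell N ν s t ε δ - compShell N ν s t ε δ' =ᵐ[P]
      compShell N ν s t (min ε δ') δ := compShell_sub hν hN hs ht hδ h
  rw [eLpNorm_congr_ae hae]
  refine (eLpNorm_compShell_le hν hN hs hst ht (le_min hε hδ'.le) hδ).trans ?_
  refine ENNReal.ofReal_le_ofReal (Real.sqrt_le_sqrt (mul_le_mul_of_nonneg_left ?_ (by linarith)))
  exact hν.smallMoment_mono (j := 0) (by simp) ((min_le_right _ _).trans h2)

lemma memLp_compShell [IsProbabilityMeasure P] (hs : 0 ≤ s) (hst : s ≤ t) (ht : t ≤ T)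
    {ε δ : ℝ} (hε : 0 ≤ ε) (hδ : 0 < δ) : MemLp (compShell N ν s t ε δ) 2 P :=
  ⟨aestronglyMeasurable_compShell hν hN hs hst ht hε hδ,
    (eLpNorm_compShell_le hν hN hs hst ht hε hδ).trans_lt ENNReal.ofReal_lt_top⟩

/-- Completeness of `L²`: two shell integrals with inner radii at most `η` differ by at most `√((t -
s) * smallMoment ν 2 η)`, which tends to `0`. -/
lemma exists_isCompSmallJumps [IsProbabilityMeasure P] (hs : 0 ≤ s) (hst : s ≤ t) (ht : t ≤ T)
    {ε : ℝ} (hε : 0 ≤ ε) : ∃ Z : Ω → ℝ, IsCompSmallJumps P N ν s t ε Z := by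
  classical
  let F : ℝ → Lp ℝ 2 P := fun δ =>
    if h : 0 < δ then (memLp_compShell hν hN hs hst ht hε h).toLp else 0
  have hF : ∀ {δ} (h : 0 < δ), F δ = (memLp_compShell hν hN hs hst ht hε h).toLp :=
    fun h => dif_pos h
  have hlim : Tendsto (fun η => √((t - s) * smallMoment ν 2 η)) (𝓝[>] 0) (𝓝 0) := by
    simpa using (hν.tendsto_smallMoment_two.const_mul (t - s)).sqrt
  have hc : Cauchy (map F (𝓝[>] 0)) := by
    rw [Metric.cauchy_iff]
    refine ⟨inferInstance, fun r hr => ?_⟩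
    obtain ⟨η, hη1, hη2⟩ := ((hlim.eventually_lt_const hr).and self_mem_nhdsWithin).exists
    have hη0 : 0 < η := hη2
    refine ⟨F '' Set.Ioc 0 η, image_mem_map (Ioc_mem_nhdsGT hη0), ?_⟩
    rintro _ ⟨δ, hδ, rfl⟩ _ ⟨δ', hδ', rfl⟩
    rw [hF hδ.1, hF hδ'.1, Lp.dist_edist, Lp.edist_toLp_toLp]
    refine lt_of_le_of_lt ?_ hη1
    exact ENNReal.toReal_le_of_le_ofReal (Real.sqrt_nonneg _)
      (eLpNorm_compShell_sub_le hν hN hs hst ht hε hδ.1 hδ'.1 hδ.2 hδ'.2)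
  obtain ⟨Z, hZ⟩ := cauchy_map_iff_exists_tendsto.1 hc
  refine ⟨Z, Lp.memLp Z, ?_⟩
  refine ((Lp.tendsto_Lp_iff_tendsto_eLpNorm' F Z).1 hZ).congr' ?_
  filter_upwards [self_mem_nhdsWithin] with δ hδ
  rw [hF hδ]
  exact eLpNorm_congr_ae (((memLp_compShell hν hN hs hst ht hε hδ).coeFn_toLp).sub .rfl)

lemma isCompSmallJumps_compSmallJumps [IsProbabilityMeasure P] (hs : 0 ≤ s) (hst : s ≤ t)
    (ht : t ≤ T) {ε : ℝ} (hε : 0 ≤ ε) :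
    IsCompSmallJumps P N ν s t ε (compSmallJumps P N ν s t ε) := by
  have H := exists_isCompSmallJumps hν hN hs hst ht hε
  rw [compSmallJumps, dif_pos H]
  exact H.choose_spec

end SmallJumps

lemma memLp_compSmallJumps {Ω : Type*} [MeasurableSpace Ω] (P : Measure Ω)
    (N : Ω → Measure (ℝ × ℝ)) (ν : Measure ℝ) (s t ε : ℝ) :
    MemLp (compSmallJumps P N ν s t ε) 2 P := by
  rw [compSmallJumps]
  split_ifs with H
  · exact H.choose_spec.1
  · exact MemLp.zero
-- Comparison of powers at the origin
section PowersAtZero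

lemma tendsto_rpow_nhdsGT_zero {a : ℝ} (ha : 0 < a) :
    Tendsto (fun x : ℝ => x ^ a) (𝓝[>] 0) (𝓝[>] 0) := by
  refine tendsto_nhdsWithin_iff.2 ⟨?_, ?_⟩
  · have h := (Real.continuousAt_rpow_const 0 a (Or.inr ha.le)).tendsto
    rw [Real.zero_rpow ha.ne'] at h
    exact h.mono_left nhdsWithin_le_nhds
  · filter_upwards [self_mem_nhdsWithin] with x hx
    exact Real.rpow_pos_of_pos hx a

lemma isLittleO_rpow_rpow_nhdsGT_zero {a b : ℝ} (h : b < a) :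
    (fun x : ℝ => x ^ a) =o[𝓝[>] 0] (fun x : ℝ => x ^ b) := by
  have h1 : (fun x : ℝ => x ^ (a - b)) =o[𝓝[>] 0] (fun _ => (1 : ℝ)) :=
    (isLittleO_one_iff ℝ).2
      ((tendsto_rpow_nhdsGT_zero (sub_pos.2 h)).mono_right nhdsWithin_le_nhds)
  refine (h1.mul_isBigO (isBigO_refl (fun x : ℝ => x ^ b) _)).congr' ?_ ?_
  · filter_upwards [self_mem_nhdsWithin] with x hx
    rw [← Real.rpow_add hx, sub_add_cancel]
  · exact Eventually.of_forall fun x => one_mul _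

lemma rpow_mul_rpow_eventuallyEq (a b : ℝ) :
    (fun x : ℝ => x ^ a * x ^ b) =ᶠ[𝓝[>] 0] fun x => x ^ (a + b) := by
  filter_upwards [self_mem_nhdsWithin] with x hx
  rw [← Real.rpow_add hx]

lemma isBigO_rpow_mul {f g : ℝ → ℝ} {a b c : ℝ} (hf : f =O[𝓝[>] 0] fun x : ℝ => x ^ a)
    (hg : g =O[𝓝[>] 0] fun x : ℝ => x ^ b) (h : a + b = c) :
    (fun x => f x * g x) =O[𝓝[>] 0] fun x : ℝ => x ^ c :=
  (hf.mul hg).trans_eventuallyEq (h ▸ rpow_mul_rpow_eventuallyEq a b)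

lemma isBigO_pow_rpow (n : ℕ) : (fun x : ℝ => x ^ n) =O[𝓝[>] 0] fun x : ℝ => x ^ (n : ℝ) := by
  simpa using isBigO_refl (fun x : ℝ => x ^ n) (𝓝[>] 0)

end PowersAtZero

/-! ### Orders of the moments and of the drift under A1 -/

section Indices

variable {ν : Measure ℝ} {α : ℝ} (hν : IsLevyMeasure ν) (hA1 : AssumptionA1 ν α)
include hν hA1

/-- For `α = 2` the comparison function would be the constant `1`, while the second moment tends to
`0`. -/
lemma index_lt_two : α < 2 := by
  refine lt_of_le_of_ne hA1.1.2 ?_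
  rintro rfl
  have h := hA1.2.2.trans_tendsto hν.tendsto_smallMoment_two
  simp only [sub_self, Real.rpow_zero] at h
  exact one_ne_zero (tendsto_nhds_unique tendsto_const_nhds h)

omit hν in
lemma exists_smallMoment_two_bounds : ∃ k K r : ℝ, 0 < k ∧ 0 < K ∧ 0 < r ∧ ∀ ε ∈ Set.Ioc 0 r,
    k * ε ^ (2 - α) ≤ smallMoment ν 2 ε ∧ smallMoment ν 2 ε ≤ K * ε ^ (2 - α) := by
  obtain ⟨K, hK, h1⟩ := hA1.2.1.exists_pos
  obtain ⟨k, hk, h2⟩ := hA1.2.2.exists_pos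
  obtain ⟨r, hr, h⟩ := mem_nhdsGT_iff_exists_Ioc_subset.1
    ((isBigOWith_iff.1 h1).and (isBigOWith_iff.1 h2))
  refine ⟨k⁻¹, K, r, inv_pos.2 hk, hK, hr, fun ε hε => ?_⟩
  obtain ⟨h3, h4⟩ := h hε
  have h5 : 0 ≤ ε ^ (2 - α) := Real.rpow_nonneg hε.1.le _
  have h6 := smallMoment_nonneg ν even_two ε
  rw [Real.norm_of_nonneg h5, Real.norm_of_nonneg h6] at h3 h4
  exact ⟨(inv_mul_le_iff₀ hk).2 h4, h3⟩

/-- Above, `x⁴ ≤ ε² x²`. Below, fix `θ` with `K θ ^ (2 - α) ≤ k / 2`, possible because `α < 2`: then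
`θ ε < |x| ≤ ε` keeps a second moment of at least `k / 2 * ε ^ (2 - α)`, and there `x⁴ ≥ θ² ε² x²`.
-/
lemma smallMoment_four_isTheta :
    (fun ε : ℝ => smallMoment ν 4 ε) =Θ[𝓝[>] 0] (fun ε : ℝ => ε ^ (4 - α)) := by
  have hα := index_lt_two hν hA1
  obtain ⟨k, K, r, hk, hK, hr, h⟩ := exists_smallMoment_two_bounds hA1
  have hpow : ∀ {ε : ℝ}, 0 < ε → ε ^ (4 - α) = ε ^ 2 * ε ^ (2 - α) := fun hε => by
    rw [← Real.rpow_natCast, ← Real.rpow_add hε]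
    norm_num
    ring_nf
  constructor
  · refine IsBigO.of_bound K ?_
    filter_upwards [Ioc_mem_nhdsGT hr] with ε hε
    rw [Real.norm_of_nonneg (smallMoment_nonneg ν (by decide) ε),
      Real.norm_of_nonneg (Real.rpow_nonneg hε.1.le _), hpow hε.1]
    calc smallMoment ν 4 ε ≤ ε ^ 2 * smallMoment ν 2 ε := hν.smallMoment_add_two_le (j := 0) (by simp) ε
      _ ≤ ε ^ 2 * (K * ε ^ (2 - α)) := mul_le_mul_of_nonneg_left (h ε hε).2 (sq_nonneg _)
      _ = _ := by ring
  · have hθ : Tendsto (fun θ : ℝ => K * θ ^ (2 - α)) (𝓝[>] 0) (𝓝 0) := by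
      simpa using ((tendsto_rpow_nhdsGT_zero (sub_pos.2 hα)).mono_right
        nhdsWithin_le_nhds).const_mul K
    obtain ⟨θ, hθ1, hθ0, hθ2⟩ := ((hθ.eventually_le_const (half_pos hk)).and
      (Ioc_mem_nhdsGT one_pos)).exists
    refine IsBigO.of_bound (θ ^ 2 * (k / 2))⁻¹ ?_
    filter_upwards [Ioc_mem_nhdsGT hr] with ε hε
    rw [Real.norm_of_nonneg (smallMoment_nonneg ν (by decide) ε),
      Real.norm_of_nonneg (Real.rpow_nonneg hε.1.le _), hpow hε.1,
      le_inv_mul_iff₀ (by positivity)]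
    have hle : θ * ε ≤ ε := by nlinarith [hε.1]
    have h1 : (θ * ε) ^ 2 * (smallMoment ν 2 ε - smallMoment ν 2 (θ * ε)) ≤ smallMoment ν 4 ε := by
      rw [hν.smallMoment_sub 0 hle]
      have h2 := hν.smallMoment_sub 2 hle
      have h3 := smallMoment_nonneg ν (j := 4) (by decide) (θ * ε)
      refine le_trans ?_ (show ∫ x in jumpShell (θ * ε) ε, x ^ 4 ∂ν ≤ _ by linarith)
      rw [← integral_const_mul]
      refine setIntegral_mono_on
        (((hν.integrableOn_pow 0 ε).mono_set fun x hx => hx.2).const_mul _)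
        ((hν.integrableOn_pow 2 ε).mono_set fun x hx => hx.2) (measurableSet_jumpShell _ _) ?_
      intro x hx
      have hx1 : (θ * ε) ^ 2 ≤ x ^ 2 := by
        rw [← sq_abs x]
        exact pow_le_pow_left₀ (mul_nonneg hθ0.le hε.1.le) hx.1.le _
      calc (θ * ε) ^ 2 * x ^ (0 + 2) ≤ x ^ 2 * x ^ 2 :=
            mul_le_mul_of_nonneg_right hx1 (sq_nonneg x)
        _ = x ^ 4 := by ring
    refine le_trans ?_ h1
    have h4 := (h ε hε).1
    have h5 := (h (θ * ε) ⟨by have := hε.1; positivity, hle.trans hε.2⟩).2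
    rw [Real.mul_rpow hθ0.le hε.1.le] at h5
    have h6 : 0 ≤ ε ^ (2 - α) := Real.rpow_nonneg hε.1.le _
    have h7 : k / 2 * ε ^ (2 - α) ≤ smallMoment ν 2 ε - smallMoment ν 2 (θ * ε) := by
      have := mul_le_mul_of_nonneg_right hθ1 h6
      nlinarith
    calc θ ^ 2 * (k / 2) * (ε ^ 2 * ε ^ (2 - α)) = (θ * ε) ^ 2 * (k / 2 * ε ^ (2 - α)) := by ring
      _ ≤ _ := mul_le_mul_of_nonneg_left h7 (sq_nonneg _)

omit hν hA1 in
lemma ell_isTheta_one {j : ℕ}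
    (h : (fun ε : ℝ => smallMoment ν j ε) =Θ[𝓝[>] 0] (fun ε : ℝ => ε ^ ((j : ℝ) - α))) :
    (fun ε : ℝ => ell ν α j ε) =Θ[𝓝[>] 0] (fun _ => (1 : ℝ)) := by
  refine (h.div (isTheta_refl (fun ε : ℝ => ε ^ ((j : ℝ) - α)) _)).trans_eventuallyEq ?_
  filter_upwards [self_mem_nhdsWithin] with ε hε
  exact div_self (Real.rpow_pos_of_pos hε _).ne'

/-- The layer-cake bound of the drift of the jumps in `(ε, 1]`. -/
lemma exists_abs_midDrift_le {κ : ℝ} (hκ : α ≤ 1 + κ) : ∃ C : ℝ, 0 < C ∧ ∀ ε ∈ Set.Ioc (0 : ℝ) 1,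
    |midDrift ν ε| ≤ C * (1 + ∫ r in ε..1, r ^ (-1 - κ)) := by
  have hα := index_lt_two hν hA1
  have := hν.sigmaFinite
  obtain ⟨k, K, r₀, hk, hK, hr₀, hb⟩ := exists_smallMoment_two_bounds hA1
  have hm1 := smallMoment_nonneg ν even_two 1
  -- A1 bounds the second moment only up to `r₀`; the second summand extends the bound `C r ^ (2 -
  -- α)` to all of `(0, 1]`, and the third absorbs the `x²` left over by the layer-cake formula.
  set C := K + smallMoment ν 2 1 * (min r₀ 1)⁻¹ ^ (2 - α) + smallMoment ν 2 1 with hC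
  have hr1 : 0 < min r₀ 1 := lt_min hr₀ one_pos
  have hp1 : 0 ≤ (min r₀ 1)⁻¹ ^ (2 - α) := by positivity
  have hCpos : 0 < C := by positivity
  have hm2 : ∀ r ∈ Set.Ioc (0 : ℝ) 1, smallMoment ν 2 r ≤ C * r ^ (2 - α) := by
    intro r hr
    have hrp : 0 < r ^ (2 - α) := Real.rpow_pos_of_pos hr.1 _
    rcases le_or_gt r r₀ with h | h
    · refine ((hb r ⟨hr.1, h⟩).2).trans (mul_le_mul_of_nonneg_right ?_ hrp.le)
      rw [hC]; nlinarith [mul_nonneg hm1 hp1]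
    · have h1 : 1 ≤ (min r₀ 1)⁻¹ ^ (2 - α) * r ^ (2 - α) := by
        rw [← Real.mul_rpow (inv_nonneg.2 hr1.le) hr.1.le]
        refine Real.one_le_rpow ?_ (by linarith)
        rw [inv_mul_eq_div, one_le_div hr1]
        exact (min_le_left _ _).trans h.le
      calc smallMoment ν 2 r ≤ smallMoment ν 2 1 := hν.smallMoment_mono (j := 0) (by simp) hr.2
        _ ≤ smallMoment ν 2 1 * ((min r₀ 1)⁻¹ ^ (2 - α) * r ^ (2 - α)) :=
          le_mul_of_one_le_right hm1 h1
        _ = smallMoment ν 2 1 * (min r₀ 1)⁻¹ ^ (2 - α) * r ^ (2 - α) := by ring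
        _ ≤ C * r ^ (2 - α) := by
          refine mul_le_mul_of_nonneg_right ?_ hrp.le
          rw [hC]; linarith
  refine ⟨C, hCpos, fun ε hε => ?_⟩
  have hint : IntervalIntegrable (fun r : ℝ => r ^ (-1 - κ)) volume ε 1 :=
    intervalIntegral.intervalIntegrable_rpow (Or.inr fun h => by
      rw [Set.uIcc_of_le hε.2] at h
      exact absurd h.1 (not_le.2 hε.1))
  have hIoc : IntegrableOn (fun r : ℝ => r ^ (-1 - κ)) (Set.Ioc ε 1) :=
    (intervalIntegrable_iff_integrableOn_Ioc_of_le hε.2).1 hint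
  have hnn : 0 ≤ ∫ r in ε..1, r ^ (-1 - κ) :=
    intervalIntegral.integral_nonneg hε.2 fun r hr => Real.rpow_nonneg (hε.1.le.trans hr.1) _
  -- pointwise layer-cake identity
  have hpt : ∀ x ∈ jumpShell ε 1, ENNReal.ofReal |x| ≤ ENNReal.ofReal (x ^ 2) +
      ∫⁻ r in Set.Ioc ε 1, ({x : ℝ | |x| ≤ r}).indicator
        (fun x => ENNReal.ofReal (x ^ 2)) x * ENNReal.ofReal (r ^ (-2 : ℝ)) := by
    intro x hx
    have hx0 : 0 < |x| := hε.1.trans hx.1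
    have h1 : ∫⁻ r in Set.Ioc |x| 1, ENNReal.ofReal (x ^ 2 * r ^ (-2 : ℝ)) ≤
        ∫⁻ r in Set.Ioc ε 1, ({x : ℝ | |x| ≤ r}).indicator
        (fun x => ENNReal.ofReal (x ^ 2)) x * ENNReal.ofReal (r ^ (-2 : ℝ)) := by
      calc _ = ∫⁻ r in Set.Ioc |x| 1, ({x : ℝ | |x| ≤ r}).indicator
            (fun x => ENNReal.ofReal (x ^ 2)) x * ENNReal.ofReal (r ^ (-2 : ℝ)) := by
            refine setLIntegral_congr_fun measurableSet_Ioc fun r hr => ?_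
            rw [Set.indicator_of_mem (by exact hr.1.le), ENNReal.ofReal_mul (sq_nonneg x)]
        _ ≤ _ := lintegral_mono_set (Set.Ioc_subset_Ioc_left hx.1.le)
    have hii : IntervalIntegrable (fun r : ℝ => r ^ (-2 : ℝ)) volume |x| 1 :=
      intervalIntegral.intervalIntegrable_rpow (Or.inr fun h => by
        rw [Set.uIcc_of_le hx.2] at h
        exact absurd h.1 (not_le.2 hx0))
    have h2 : ∫⁻ r in Set.Ioc |x| 1, ENNReal.ofReal (x ^ 2 * r ^ (-2 : ℝ)) =
        ENNReal.ofReal (|x| - x ^ 2) := by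
      rw [← ofReal_integral_eq_lintegral_ofReal
        (((intervalIntegrable_iff_integrableOn_Ioc_of_le hx.2).1 hii).const_mul _)
        ((ae_restrict_iff' measurableSet_Ioc).2 (ae_of_all _ fun r hr =>
          mul_nonneg (sq_nonneg x) (Real.rpow_nonneg (hx0.le.trans hr.1.le) _))),
        integral_const_mul, ← intervalIntegral.integral_of_le hx.2,
        integral_rpow (Or.inr ⟨by norm_num, fun h => by
          rw [Set.uIcc_of_le hx.2] at h
          exact absurd h.1 (not_le.2 hx0)⟩)]
      congr 1
      have : (-2 + 1 : ℝ) = -1 := by norm_num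
      rw [this, Real.one_rpow, Real.rpow_neg_one, ← sq_abs x]
      field_simp
      ring
    calc ENNReal.ofReal |x| = ENNReal.ofReal (x ^ 2 + (|x| - x ^ 2)) := by ring_nf
      _ ≤ ENNReal.ofReal (x ^ 2) + ENNReal.ofReal (|x| - x ^ 2) := ENNReal.ofReal_add_le
      _ ≤ _ := by rw [← h2]; gcongr
  have hmeas : Measurable (Function.uncurry fun (x r : ℝ) => ({x : ℝ | |x| ≤ r}).indicator
        (fun x => ENNReal.ofReal (x ^ 2)) x * ENNReal.ofReal (r ^ (-2 : ℝ))) := by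
    have hset : MeasurableSet {p : ℝ × ℝ | |p.1| ≤ p.2} :=
      measurableSet_le (measurable_abs.comp measurable_fst) measurable_snd
    have h1 : Measurable (({p : ℝ × ℝ | |p.1| ≤ p.2}).indicator
        fun p => ENNReal.ofReal (p.1 ^ 2)) := Measurable.indicator (by fun_prop) hset
    have h2 : Measurable fun p : ℝ × ℝ => ENNReal.ofReal (p.2 ^ (-2 : ℝ)) := by fun_prop
    exact h1.mul h2
  have hmom : ∀ r, ∫⁻ x, ({x : ℝ | |x| ≤ r}).indicator (fun x => ENNReal.ofReal (x ^ 2)) x ∂ν =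
      ENNReal.ofReal (smallMoment ν 2 r) := fun r => by
    rw [lintegral_indicator (measurableSet_abs_le r), smallMoment,
      ofReal_integral_eq_lintegral_ofReal (hν.integrableOn_pow 0 r)
        (ae_of_all _ fun x => sq_nonneg x)]
  -- Integrating `|x| = x² + ∫_{|x|}^1 x² r⁻² dr` over the shell and swapping the integrals bounds
  -- the drift by `m₂(1) + ∫_ε^1 m₂(r) r⁻² dr`, whose integrand is at most `C r ^ (-α) ≤ C r ^ (-1 -
  -- κ)`.
  have key : ∫⁻ x in jumpShell ε 1, ENNReal.ofReal |x| ∂ν ≤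
      ENNReal.ofReal (C * (1 + ∫ r in ε..1, r ^ (-1 - κ))) := by
    calc ∫⁻ x in jumpShell ε 1, ENNReal.ofReal |x| ∂ν
        ≤ ∫⁻ x in jumpShell ε 1, (ENNReal.ofReal (x ^ 2) +
          ∫⁻ r in Set.Ioc ε 1, ({x : ℝ | |x| ≤ r}).indicator
          (fun x => ENNReal.ofReal (x ^ 2)) x * ENNReal.ofReal (r ^ (-2 : ℝ))) ∂ν :=
          setLIntegral_mono' (measurableSet_jumpShell _ _) hpt
      _ = ∫⁻ x in jumpShell ε 1, ENNReal.ofReal (x ^ 2) ∂ν + ∫⁻ x in jumpShell ε 1,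
          (∫⁻ r in Set.Ioc ε 1, ({x : ℝ | |x| ≤ r}).indicator
          (fun x => ENNReal.ofReal (x ^ 2)) x * ENNReal.ofReal (r ^ (-2 : ℝ))) ∂ν :=
          lintegral_add_left (by fun_prop) _
      _ ≤ ENNReal.ofReal (smallMoment ν 2 1) + ∫⁻ r in Set.Ioc ε 1,
          ENNReal.ofReal (C * r ^ (-1 - κ)) := by
          refine add_le_add ?_ ?_
          · rw [← hmom, lintegral_indicator (measurableSet_abs_le 1)]
            exact lintegral_mono_set fun x hx => hx.2
          · rw [lintegral_lintegral_swap hmeas.aemeasurable]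
            refine setLIntegral_mono' measurableSet_Ioc fun r hr => ?_
            have hr0 : 0 < r := hε.1.trans hr.1
            rw [lintegral_mul_const _ (Measurable.indicator (by fun_prop) (measurableSet_abs_le r))]
            calc _ ≤ (∫⁻ x, ({x : ℝ | |x| ≤ r}).indicator (fun x => ENNReal.ofReal (x ^ 2)) x ∂ν) *
                  ENNReal.ofReal (r ^ (-2 : ℝ)) := by
                  gcongr
                  exact Measure.restrict_le_self
              _ = ENNReal.ofReal (smallMoment ν 2 r * r ^ (-2 : ℝ)) := by
                  rw [hmom, ENNReal.ofReal_mul (smallMoment_nonneg ν even_two r)]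
              _ ≤ _ := by
                  refine ENNReal.ofReal_le_ofReal ?_
                  calc smallMoment ν 2 r * r ^ (-2 : ℝ)
                      ≤ C * r ^ (2 - α) * r ^ (-2 : ℝ) :=
                        mul_le_mul_of_nonneg_right (hm2 r ⟨hr0, hr.2⟩) (Real.rpow_nonneg hr0.le _)
                    _ = C * r ^ (-α) := by
                        rw [mul_assoc, ← Real.rpow_add hr0]; ring_nf
                    _ ≤ _ := by
                        refine mul_le_mul_of_nonneg_left ?_ hCpos.le
                        exact Real.rpow_le_rpow_of_exponent_ge hr0 hr.2 (by linarith)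
      _ = ENNReal.ofReal (smallMoment ν 2 1) +
          ENNReal.ofReal (C * ∫ r in ε..1, r ^ (-1 - κ)) := by
          rw [intervalIntegral.integral_of_le hε.2, ← integral_const_mul,
            ofReal_integral_eq_lintegral_ofReal (hIoc.const_mul C)
            ((ae_restrict_iff' measurableSet_Ioc).2 (ae_of_all _ fun r hr =>
              mul_nonneg hCpos.le (Real.rpow_nonneg (hε.1.le.trans hr.1.le) _)))]
      _ = ENNReal.ofReal (smallMoment ν 2 1 + C * ∫ r in ε..1, r ^ (-1 - κ)) :=
          (ENNReal.ofReal_add hm1 (mul_nonneg hCpos.le hnn)).symm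
      _ ≤ _ := by
          refine ENNReal.ofReal_le_ofReal ?_
          rw [mul_add, mul_one]
          have : smallMoment ν 2 1 ≤ C := by
            rw [hC]; nlinarith [mul_nonneg hm1 hp1]
          linarith
  have h1 := enorm_integral_le_lintegral_enorm (μ := ν.restrict (jumpShell ε 1)) (fun x : ℝ => x)
  simp only [Real.enorm_eq_ofReal_abs] at h1
  exact (ENNReal.ofReal_le_ofReal_iff (by positivity)).1 (h1.trans key)

/-- The exponent is left free: `κ = α - 1` gives the natural order for `α > 1`, and a small `κ`
absorbs the logarithm at `α = 1`. -/
lemma midDrift_isBigO_rpow {κ : ℝ} (hκ : 0 < κ) (hακ : α ≤ 1 + κ) :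
    midDrift ν =O[𝓝[>] 0] fun ε : ℝ => ε ^ (-κ) := by
  obtain ⟨C, hC, h⟩ := exists_abs_midDrift_le hν hA1 hακ
  refine IsBigO.of_bound (C * (1 + 1 / κ)) ?_
  filter_upwards [Ioc_mem_nhdsGT one_pos] with ε hε
  have h0 : 1 ≤ ε ^ (-κ) := Real.one_le_rpow_of_pos_of_le_one_of_nonpos hε.1 hε.2 (by linarith)
  rw [Real.norm_of_nonneg (zero_le_one.trans h0), mul_assoc]
  refine (h ε hε).trans (mul_le_mul_of_nonneg_left ?_ hC.le)
  rw [integral_rpow (Or.inr ⟨by linarith, fun h => by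
    rw [Set.uIcc_of_le hε.2] at h
    exact absurd h.1 (not_le.2 hε.1)⟩)]
  have h2 : (1 ^ (-1 - κ + 1) - ε ^ (-1 - κ + 1)) / (-1 - κ + 1) = (ε ^ (-κ) - 1) / κ := by
    rw [Real.one_rpow, show -1 - κ + 1 = -κ by ring, div_neg, ← neg_div, neg_sub]
  rw [h2, add_mul, one_mul, one_div_mul_eq_div]
  gcongr
  linarith

lemma midDrift_isBigO_one (hα1 : α < 1) : midDrift ν =O[𝓝[>] 0] fun _ => (1 : ℝ) := by
  obtain ⟨C, hC, h⟩ := exists_abs_midDrift_le hν hA1 (κ := α - 1) (by linarith)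
  refine IsBigO.of_bound (C * (1 + 1 / (1 - α))) ?_
  filter_upwards [Ioc_mem_nhdsGT one_pos] with ε hε
  rw [norm_one, mul_one]
  refine (h ε hε).trans (mul_le_mul_of_nonneg_left ?_ hC.le)
  rw [integral_rpow (Or.inl (by linarith)), Real.one_rpow, show -1 - (α - 1) + 1 = 1 - α by ring]
  have := sub_pos.2 hα1
  have := Real.rpow_nonneg hε.1.le (1 - α)
  gcongr
  linarith

lemma midDrift_isBigO_log (hα1 : α = 1) :
    midDrift ν =O[𝓝[>] 0] fun ε : ℝ => Real.log (1 / (2 * ε)) := by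
  obtain ⟨C, hC, h⟩ := exists_abs_midDrift_le hν hA1 (κ := 0) (by linarith)
  have h4 : Real.log 4 = 2 * Real.log 2 := by
    rw [show (4 : ℝ) = 2 ^ 2 by norm_num, Real.log_pow]; norm_num
  have hl2 := Real.log_pos one_lt_two
  refine IsBigO.of_bound (C * (1 / Real.log 2 + 2)) ?_
  -- For `ε ≤ 1 / 4` the comparison logarithm is at least `log 2`, hence dominates both `1` and
  -- `-log ε`.
  filter_upwards [Ioc_mem_nhdsGT (show (0 : ℝ) < 1 / 4 by norm_num)] with ε hε
  have hε1 : ε ∈ Set.Ioc (0 : ℝ) 1 := ⟨hε.1, hε.2.trans (by norm_num)⟩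
  have hlog : Real.log ε ≤ - (2 * Real.log 2) := by
    rw [← h4, ← Real.log_inv]
    exact Real.log_le_log hε.1 (by simpa using hε.2)
  have he : Real.log (1 / (2 * ε)) = - Real.log 2 - Real.log ε := by
    rw [one_div, Real.log_inv, Real.log_mul two_ne_zero hε.1.ne']; ring
  have hint : ∫ r in ε..1, r ^ (-1 - 0 : ℝ) = - Real.log ε := by
    have : ∀ r : ℝ, r ^ (-1 - 0 : ℝ) = r⁻¹ := fun r => by rw [sub_zero, Real.rpow_neg_one]
    simp_rw [this]
    rw [integral_inv_of_pos hε.1 one_pos, one_div, Real.log_inv]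
  rw [Real.norm_of_nonneg (show 0 ≤ Real.log (1 / (2 * ε)) by rw [he]; linarith), mul_assoc]
  refine (h ε hε1).trans (mul_le_mul_of_nonneg_left ?_ hC.le)
  rw [hint, he]
  have : 1 ≤ 1 / Real.log 2 * (- Real.log 2 - Real.log ε) := by
    rw [one_div_mul_eq_div, one_le_div hl2]; linarith
  linarith

end Indices
-- Negligibility of the error terms
section Rates

variable {ν : Measure ℝ} {α : ℝ} (hν : IsLevyMeasure ν) (hA1 : AssumptionA1 ν α)
include hν hA1

/-- The scale `√(∫_{|x| ≤ ε} x⁴ ν(dx))` is at least of order `ε ^ (2 - α / 2)`. -/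
lemma rpow_isBigO_sqrt_smallMoment_four :
    (fun ε : ℝ => ε ^ (2 - α / 2)) =O[𝓝[>] 0] fun ε => √(smallMoment ν 4 ε) := by
  have h := (smallMoment_four_isTheta hν hA1).2
  obtain ⟨C, hC, h1⟩ := h.exists_pos
  refine IsBigO.of_bound √C ?_
  filter_upwards [self_mem_nhdsWithin, isBigOWith_iff.1 h1] with ε hε h2
  have hε0 : 0 < ε := hε
  have h3 : ε ^ (2 - α / 2) = √(ε ^ (4 - α)) := by
    rw [Real.sqrt_eq_rpow, ← Real.rpow_mul hε0.le]
    ring_nf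
  rw [h3, Real.norm_of_nonneg (Real.sqrt_nonneg _), Real.norm_of_nonneg (Real.sqrt_nonneg _),
    ← Real.sqrt_mul hC.le]
  rw [Real.norm_of_nonneg (Real.rpow_nonneg hε0.le _),
    Real.norm_of_nonneg (smallMoment_nonneg ν (by decide) _)] at h2
  exact Real.sqrt_le_sqrt h2

lemma eventually_smallMoment_four_pos : ∀ᶠ ε in 𝓝[>] 0, 0 < smallMoment ν 4 ε := by
  obtain ⟨C, hC, h⟩ := (rpow_isBigO_sqrt_smallMoment_four hν hA1).exists_pos
  filter_upwards [self_mem_nhdsWithin, isBigOWith_iff.1 h] with ε hε h2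
  have h3 : 0 < ε ^ (2 - α / 2) := Real.rpow_pos_of_pos hε _
  rw [Real.norm_of_nonneg h3.le, Real.norm_of_nonneg (Real.sqrt_nonneg _)] at h2
  exact Real.sqrt_pos.1 (pos_of_mul_pos_right (h3.trans_le h2) hC.le)

lemma tendsto_div_sqrt_smallMoment_four {f : ℝ → ℝ} {a : ℝ}
    (hf : f =O[𝓝[>] 0] fun ε : ℝ => ε ^ a) (ha : 2 - α / 2 < a) :
    Tendsto (fun ε => f ε / √(smallMoment ν 4 ε)) (𝓝[>] 0) (𝓝 0) :=
  ((hf.trans_isLittleO (isLittleO_rpow_rpow_nhdsGT_zero ha)).trans_isBigO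
    (rpow_isBigO_sqrt_smallMoment_four hν hA1)).tendsto_div_nhds_zero

omit hν in
lemma sqrt_smallMoment_two_isBigO :
    (fun ε => √(smallMoment ν 2 ε)) =O[𝓝[>] 0] fun ε : ℝ => ε ^ (1 - α / 2) := by
  obtain ⟨C, hC, h1⟩ := hA1.2.1.exists_pos
  refine IsBigO.of_bound √C ?_
  filter_upwards [self_mem_nhdsWithin, isBigOWith_iff.1 h1] with ε hε h2
  have hε0 : 0 < ε := hε
  have h3 : ε ^ (1 - α / 2) = √(ε ^ (2 - α)) := by
    rw [Real.sqrt_eq_rpow, ← Real.rpow_mul hε0.le]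
    ring_nf
  rw [h3, Real.norm_of_nonneg (Real.sqrt_nonneg _), Real.norm_of_nonneg (Real.sqrt_nonneg _),
    ← Real.sqrt_mul hC.le]
  rw [Real.norm_of_nonneg (Real.rpow_nonneg hε0.le _),
    Real.norm_of_nonneg (smallMoment_nonneg ν even_two _)] at h2
  exact Real.sqrt_le_sqrt h2

/-- Lindeberg-type condition: the largest possible squared jump is small against the standard
deviation. In exponents, `2 > 2 - α / 2`. -/
lemma tendsto_sq_div_sqrt_smallMoment_four (hα : α ≠ 0) :
    Tendsto (fun ε : ℝ => ε ^ 2 / √(smallMoment ν 4 ε)) (𝓝[>] 0) (𝓝 0) := by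
  have := lt_of_le_of_ne hA1.1.1 hα.symm
  exact tendsto_div_sqrt_smallMoment_four hν hA1 (isBigO_pow_rpow 2) (by push_cast; linarith)

/-- Controls the distance of the sum of squares from the quadratic variation, the factor `ε`
bounding `√h`. In exponents, `3 - α > 2 - α / 2`. -/
lemma tendsto_mul_smallMoment_two_div_sqrt_smallMoment_four :
    Tendsto (fun ε : ℝ => ε * smallMoment ν 2 ε / √(smallMoment ν 4 ε)) (𝓝[>] 0) (𝓝 0) := by
  have := index_lt_two hν hA1
  refine tendsto_div_sqrt_smallMoment_four hν hA1 (a := 1 + (2 - α))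
    (isBigO_rpow_mul ?_ hA1.2.1 rfl) (by linarith)
  simpa using isBigO_refl (fun x : ℝ => x) (𝓝[>] 0)

/-- Controls the cross term of drift and jumps, with `ε²` bounding `h`. A drift of order `ε ^ (-κ)`
leaves the exponent `3 - κ - α / 2`, so any `κ < 1` will do; the maximum with `1 / 2` keeps `κ`
positive for every `α`. -/
lemma tendsto_drift_cross_div_sqrt_smallMoment_four :
    Tendsto (fun ε : ℝ => ε ^ 2 * midDrift ν ε * √(smallMoment ν 2 ε) / √(smallMoment ν 4 ε))
      (𝓝[>] 0) (𝓝 0) := by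
  have h2 := index_lt_two hν hA1
  have hκ : 0 < max (α - 1) (1 / 2) := lt_max_of_lt_right (by norm_num)
  have hκ1 : max (α - 1) (1 / 2) < 1 := max_lt (by linarith) (by norm_num)
  refine tendsto_div_sqrt_smallMoment_four hν hA1
    (a := (((2 : ℕ) : ℝ) + -max (α - 1) (1 / 2)) + (1 - α / 2))
    (isBigO_rpow_mul (isBigO_rpow_mul (isBigO_pow_rpow 2)
      (midDrift_isBigO_rpow hν hA1 hκ ?_) rfl) (sqrt_smallMoment_two_isBigO hA1) rfl) ?_
  · have := le_max_left (α - 1) (1 / 2)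
    linarith
  · push_cast
    linarith

omit hν hA1 in
/-- For `α > 1`, `ε ^ (1 - α)` dominates the constant `c`. -/
lemma inv_add_rpow_isBigO (c : ℝ) (hα1 : 1 < α) :
    (fun ε : ℝ => (c + ε ^ (1 - α))⁻¹) =O[𝓝[>] 0] fun ε : ℝ => ε ^ (α - 1) := by
  have hlim : Tendsto (fun ε : ℝ => (c * ε ^ (α - 1) + 1)⁻¹) (𝓝[>] 0) (𝓝 1) := by
    have := (((tendsto_rpow_nhdsGT_zero (sub_pos.2 hα1)).mono_right
      nhdsWithin_le_nhds).const_mul c).add_const 1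
    simpa using this.inv₀ (by simp)
  have h := (isBigO_refl (fun ε : ℝ => ε ^ (α - 1)) (𝓝[>] 0)).mul (hlim.isBigO_one ℝ)
  refine h.congr' ?_ (Eventually.of_forall fun ε => mul_one _)
  filter_upwards [self_mem_nhdsWithin] with ε hε
  have hε0 : 0 < ε := hε
  have h1 : ε ^ (1 - α) * ε ^ (α - 1) = 1 := by
    rw [← Real.rpow_add hε0]; simp
  have h2 : c * ε ^ (α - 1) + 1 = (c + ε ^ (1 - α)) * ε ^ (α - 1) := by
    rw [add_mul, h1]
  rw [h2, mul_inv, mul_comm, mul_assoc, inv_mul_cancel₀ (Real.rpow_pos_of_pos hε0 _).ne', mul_one]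

omit hν hA1 in
lemma inv_add_rpow_isBigO_one {c : ℝ} (hc : c ≠ 0) (hα1 : α < 1) :
    (fun ε : ℝ => (c + ε ^ (1 - α))⁻¹) =O[𝓝[>] 0] fun _ => (1 : ℝ) := by
  have h := (((tendsto_rpow_nhdsGT_zero (sub_pos.2 hα1)).mono_right
    nhdsWithin_le_nhds).const_add c).inv₀ (by simpa using hc)
  exact h.isBigO_one ℝ

/-- In each regime the denominator is at least of the order bounding the drift; `c ≠ 0` enters for
`α < 1`, where the denominator tends to `c`. -/
lemma ellOne_isBigO_one {c : ℝ} (hc : c ≠ 0) :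
    ellOne ν α c =O[𝓝[>] 0] fun _ => (1 : ℝ) := by
  rcases lt_trichotomy α 1 with h | h | h
  · have h1 := (midDrift_isBigO_one hν hA1 h).mul (inv_add_rpow_isBigO_one hc h)
    have he : ellOne ν α c = fun ε => midDrift ν ε * (c + ε ^ (1 - α))⁻¹ :=
      funext fun ε => by rw [ellOne, if_neg h.ne, div_eq_mul_inv]
    rw [he]
    simpa using h1
  · have he : ellOne ν α c = fun ε => midDrift ν ε / Real.log (1 / (2 * ε)) :=
      funext fun ε => by rw [ellOne, if_pos h]
    rw [he]
    refine ((midDrift_isBigO_log hν hA1 h).mul (isBigO_refl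
      (fun ε : ℝ => (Real.log (1 / (2 * ε)))⁻¹) _)).trans (IsBigO.of_bound 1 ?_)
    refine Eventually.of_forall fun ε => ?_
    rw [norm_one, mul_one]
    by_cases h0 : Real.log (1 / (2 * ε)) = 0
    · rw [h0, zero_mul, norm_zero]
      exact zero_le_one
    · rw [mul_inv_cancel₀ h0, norm_one]
  · have h1 := isBigO_rpow_mul (c := 0) (midDrift_isBigO_rpow hν hA1 (κ := α - 1) (by linarith)
      (by linarith)) (inv_add_rpow_isBigO c h) (by ring)
    have he : ellOne ν α c = fun ε => midDrift ν ε * (c + ε ^ (1 - α))⁻¹ :=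
      funext fun ε => by rw [ellOne, if_neg h.ne', div_eq_mul_inv]
    rw [he]
    simpa using h1

open Classical in
/-- The error made by centring with `ℓ₁` instead of the exact drift is negligible. -/
lemma tendsto_drift_centering_div_sqrt_smallMoment_four (hα : α ≠ 0) (c : ℝ) :
    Tendsto (fun ε : ℝ => ε ^ 2 * (midDrift ν ε ^ 2 - ellOne ν α c ε ^ 2 * ε ^ (2 - 2 * α) *
      (if α = 1 then 0 else 1)) / √(smallMoment ν 4 ε)) (𝓝[>] 0) (𝓝 0) := by
  have h2 := index_lt_two hν hA1
  have h0 := lt_of_le_of_ne hA1.1.1 hα.symm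
  have hsq : ∀ {ε : ℝ}, 0 < ε → ε ^ (2 - 2 * α) = (ε ^ (1 - α)) ^ 2 := fun hε => by
    rw [← Real.rpow_natCast, ← Real.rpow_mul hε.le]
    push_cast
    ring_nf
  rcases lt_trichotomy α 1 with h | h | h
  · have hd := midDrift_isBigO_one hν hA1 h
    have hρ : (fun ε => midDrift ν ε ^ 2 - ellOne ν α c ε ^ 2 * ε ^ (2 - 2 * α) *
        (if α = 1 then 0 else 1)) =O[𝓝[>] 0] fun ε : ℝ => ε ^ (0 : ℝ) := by
      simp only [Real.rpow_zero, if_neg h.ne, mul_one]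
      -- For `c = 0` the two drift terms cancel exactly; otherwise both are bounded, and the factor
      -- `ε²` suffices since `α > 0`.
      by_cases hc : c = 0
      · refine IsBigO.congr' (isBigO_zero (fun _ => (1 : ℝ)) _) ?_ .rfl
        filter_upwards [self_mem_nhdsWithin] with ε hε
        have hp : (ε : ℝ) ^ (1 - α) ≠ 0 := (Real.rpow_pos_of_pos hε _).ne'
        rw [hsq hε, ellOne, if_neg h.ne, hc, zero_add, div_pow, div_mul_cancel₀ _ (pow_ne_zero 2 hp),
          sub_self]
      · have he := ellOne_isBigO_one hν hA1 hc
        have hp : (fun ε : ℝ => ε ^ (2 - 2 * α)) =O[𝓝[>] 0] fun _ => (1 : ℝ) :=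
          ((tendsto_rpow_nhdsGT_zero (by linarith)).mono_right nhdsWithin_le_nhds).isBigO_one ℝ
        have h3 := (hd.pow 2).sub (((he.pow 2).mul hp).congr_right (fun _ => by simp))
        simpa using h3
    exact tendsto_div_sqrt_smallMoment_four hν hA1 (isBigO_rpow_mul (isBigO_pow_rpow 2) hρ rfl)
      (by push_cast; linarith)
  -- At `α = 1` no correction is subtracted, so `ε² d²` itself must be `o(ε ^ (3 / 2))`; any `κ < 1
  -- / 4` works.
  · have hd := midDrift_isBigO_rpow hν hA1 (κ := 1 / 8) (by norm_num) (by linarith)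
    simp only [if_pos h, mul_zero, sub_zero]
    refine tendsto_div_sqrt_smallMoment_four hν hA1 (isBigO_rpow_mul (isBigO_pow_rpow 2)
      (b := -(1 / 8) + -(1 / 8)) ?_ rfl) (by push_cast; linarith)
    simp only [sq]
    exact isBigO_rpow_mul hd hd rfl
  · have hd := midDrift_isBigO_rpow hν hA1 (κ := α - 1) (by linarith) (by linarith)
    have hi := inv_add_rpow_isBigO c h
    have hi1 : (fun ε : ℝ => 1 + ε ^ (1 - α) * (c + ε ^ (1 - α))⁻¹) =O[𝓝[>] 0]
        fun ε : ℝ => ε ^ (0 : ℝ) := by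
      have h3 := isBigO_rpow_mul (isBigO_refl (fun ε : ℝ => ε ^ (1 - α)) _) hi
        (c := 0) (by ring)
      simp only [Real.rpow_zero] at h3 ⊢
      exact (isBigO_refl _ _).add h3
    -- With `q = ε ^ (1 - α) / (c + ε ^ (1 - α))` the difference is `d² (1 - q) (1 + q)`, and `1 - q
    -- = c / (c + ε ^ (1 - α))` gains a factor `ε ^ (α - 1)` over `d²`.
    have hmain : (fun ε : ℝ => midDrift ν ε * midDrift ν ε * (c * (c + ε ^ (1 - α))⁻¹ *
        (1 + ε ^ (1 - α) * (c + ε ^ (1 - α))⁻¹))) =O[𝓝[>] 0] fun ε : ℝ => ε ^ (1 - α) :=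
      isBigO_rpow_mul (isBigO_rpow_mul hd hd rfl)
        (isBigO_rpow_mul (hi.const_mul_left c) hi1 rfl) (by ring)
    have hne : ∀ᶠ ε : ℝ in 𝓝[>] 0, c + ε ^ (1 - α) ≠ 0 := by
      filter_upwards [(tendsto_rpow_neg_nhdsGT_zero (show 1 - α < 0 by linarith)).eventually_gt_atTop
        (-c)] with ε hε
      linarith
    refine tendsto_div_sqrt_smallMoment_four hν hA1 (isBigO_rpow_mul (isBigO_pow_rpow 2)
      (hmain.congr' ?_ .rfl) rfl) (by push_cast; linarith)
    filter_upwards [self_mem_nhdsWithin, hne] with ε hε hne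
    rw [hsq hε, ellOne, if_neg h.ne', if_neg h.ne']
    field_simp
    ring

end Rates
-- From squared increments to squared jumps
section GridSums

variable {Ω : Type*} [MeasurableSpace Ω] {P : Measure Ω}

lemma sum_setIntegral_grid {μ : Measure (ℝ × ℝ)} {F : Type*} [NormedAddCommGroup F]
    [NormedSpace ℝ F] {f : ℝ × ℝ → F} {B : Set ℝ} (hB : MeasurableSet B) {h : ℝ} (hh : 0 ≤ h)
    (n : ℕ) (hf : IntegrableOn f (Set.Ioc 0 (n * h) ×ˢ B) μ) :
    ∑ i ∈ Finset.range n, ∫ z in Set.Ioc ((i : ℝ) * h) (((i : ℝ) + 1) * h) ×ˢ B, f z ∂μ =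
      ∫ z in Set.Ioc 0 (n * h) ×ˢ B, f z ∂μ := by
  induction n with
  | zero => simp
  | succ n ih =>
    have hn : 0 ≤ (n : ℝ) * h := by positivity
    have hn1 : (n : ℝ) * h ≤ ((n : ℝ) + 1) * h := by nlinarith
    have hU : Set.Ioc 0 (((n + 1 : ℕ) : ℝ) * h) ×ˢ B =
        Set.Ioc 0 ((n : ℝ) * h) ×ˢ B ∪ Set.Ioc ((n : ℝ) * h) (((n : ℝ) + 1) * h) ×ˢ B := by
      rw [← Set.union_prod, Set.Ioc_union_Ioc_eq_Ioc hn hn1]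
      push_cast
      rfl
    rw [hU] at hf ⊢
    rw [Finset.sum_range_succ, ih hf.left_of_union, setIntegral_union
      (Set.disjoint_prod.2 (Or.inl (Set.Ioc_disjoint_Ioc_of_le le_rfl)))
      (measurableSet_Ioc.prod hB) hf.left_of_union hf.right_of_union]

lemma eLpNorm_mul_le_two {f g : Ω → ℝ} (hf : AEStronglyMeasurable f P)
    (hg : AEStronglyMeasurable g P) :
    eLpNorm (fun ω => f ω * g ω) 1 P ≤ eLpNorm f 2 P * eLpNorm g 2 P :=
  eLpNorm_smul_le_mul_eLpNorm (E := ℝ) (𝕜 := ℝ) (p := 2) (q := 2) (r := 1) (f := g) (φ := f) hg hf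

variable {ν : Measure ℝ} {T : ℝ} {N : Ω → Measure (ℝ × ℝ)} (hν : IsLevyMeasure ν)
  (hN : IsPoissonRandomMeasure P N ((volume.restrict (Set.Icc 0 T)).prod ν))
include hν hN

/-- Makes the cross term a multiple of one increment over `(0, T]`, with norm at most `√(T m₂)` and
no loss from the number of grid cells. -/
lemma sum_compShell_grid (hT : 0 ≤ T) {n : ℕ} (hn : n ≠ 0) {ε δ : ℝ} (hδ : 0 < δ) :
    ∀ᵐ ω ∂P, ∑ i ∈ Finset.range n,
      compShell N ν ((i : ℝ) * (T / n)) (((i : ℝ) + 1) * (T / n)) ε δ ω =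
        compShell N ν 0 T ε δ ω := by
  have hn' : (n : ℝ) ≠ 0 := Nat.cast_ne_zero.2 hn
  have hnT : (n : ℝ) * (T / n) = T := mul_div_cancel₀ T hn'
  filter_upwards [integrableOn_snd_jumpShell hν hN le_rfl le_rfl (ε := ε) hδ 1] with ω hω
  have h := sum_setIntegral_grid (measurableSet_jumpShell δ ε) (div_nonneg hT n.cast_nonneg) n
    (f := fun z : ℝ × ℝ => z.2) (μ := N ω) (by simpa [hnT] using hω)
  simp only [compShell, Finset.sum_sub_distrib, h, hnT]
  congr 1
  rw [← Finset.sum_mul]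
  congr 1
  have : ∀ i : ℕ, ((i : ℝ) + 1) * (T / n) - i * (T / n) = T / n := fun i => by ring
  simp [this, hnT]

lemma aestronglyMeasurable_quadVar {δ ε : ℝ} (hδ : 0 < δ) :
    AEStronglyMeasurable (fun ω => ∫ z in Set.Ioc 0 T ×ˢ jumpShell δ ε, z.2 ^ 2 ∂(N ω)) P := by
  have := hν.sigmaFinite
  have h := hN.aestronglyMeasurable_setIntegral (f := fun z : ℝ × ℝ => truncate |ε| z.2 ^ 2)
    (C := |ε| ^ 2) (measurableSet_Ioc.prod (measurableSet_jumpShell δ |ε|))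
    (measure_prod_Ioc_lt_top le_rfl le_rfl (hν.measure_jumpShell_lt_top hδ |ε|) (s := 0) (t := T))
    (((measurable_truncate |ε|).comp measurable_snd).pow_const 2)
    (fun z => by
      rw [abs_pow]
      exact pow_le_pow_left₀ (abs_nonneg _) (abs_truncate_le (abs_nonneg ε) z.2) 2)
  simp only [setIntegral_truncate _ _ _ _ _ (fun x : ℝ => x ^ 2)] at h
  rcases le_or_gt 0 ε with hε | hε
  · rwa [abs_of_nonneg hε] at h
  · have hemp : jumpShell δ ε = ∅ := Set.eq_empty_of_forall_notMem fun x hx => by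
      have := abs_nonneg x
      linarith [hx.2]
    simp only [hemp, Set.prod_empty, Measure.restrict_empty, integral_zero_measure]
    exact aestronglyMeasurable_const

variable [IsProbabilityMeasure P]

lemma eLpNorm_sum_compShell_sq_sub_le (hT : 0 ≤ T) {n : ℕ} (hn : n ≠ 0) {ε δ : ℝ} (hε : 0 ≤ ε)
    (hδ : 0 < δ) :
    eLpNorm (fun ω => ∑ i ∈ Finset.range n,
      compShell N ν ((i : ℝ) * (T / n)) (((i : ℝ) + 1) * (T / n)) ε δ ω ^ 2 -
        ∫ z in Set.Ioc 0 T ×ˢ jumpShell δ ε, z.2 ^ 2 ∂(N ω)) 2 P ≤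
      ENNReal.ofReal √(2 * (T * (T / n) * smallMoment ν 2 ε ^ 2)) := by
  have := hν.sigmaFinite
  have hn' : (n : ℝ) ≠ 0 := Nat.cast_ne_zero.2 hn
  have hnT : (n : ℝ) * (T / n) = T := mul_div_cancel₀ T hn'
  have hh : 0 ≤ T / n := div_nonneg hT n.cast_nonneg
  have hlo : ∀ i : ℕ, 0 ≤ (i : ℝ) * (T / n) := fun i => by positivity
  have hmid : ∀ i : ℕ, (i : ℝ) * (T / n) ≤ ((i : ℝ) + 1) * (T / n) := fun i => by nlinarith
  have hhi : ∀ i : Fin n, (((i : ℕ) : ℝ) + 1) * (T / n) ≤ T := fun i => by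
    calc (((i : ℕ) : ℝ) + 1) * (T / n) ≤ n * (T / n) :=
          mul_le_mul_of_nonneg_right (by exact_mod_cast i.2) hh
      _ = T := hnT
  let A : Fin n → Set (ℝ × ℝ) := fun i =>
    Set.Ioc (((i : ℕ) : ℝ) * (T / n)) ((((i : ℕ) : ℝ) + 1) * (T / n)) ×ˢ jumpShell δ ε
  have hd : Pairwise fun i j => Disjoint (A i) (A j) := by
    have key : ∀ i j : Fin n, i < j → Disjoint (A i) (A j) := fun i j hij => by
      refine Set.disjoint_prod.2 (Or.inl (Set.Ioc_disjoint_Ioc_of_le ?_))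
      refine mul_le_mul_of_nonneg_right ?_ hh
      exact_mod_cast hij
    intro i j hij
    rcases lt_or_gt_of_ne hij with h | h
    · exact key i j h
    · exact (key j i h).symm
  have hsub : jumpShell δ ε ⊆ {x | |x| ≤ ε} := fun x hx => hx.2
  have hmain := hN.eLpNorm_sum_sq_sub_quadVar_le (A := A) (C := ε)
    (f := fun z : ℝ × ℝ => truncate ε z.2)
    (fun i => measurableSet_Ioc.prod (measurableSet_jumpShell _ _))
    (fun i => measure_prod_Ioc_lt_top (hlo i) (hhi i) (hν.measure_jumpShell_lt_top hδ ε)) hd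
    ((measurable_truncate ε).comp measurable_snd) (fun z => abs_truncate_le hε z.2)
  refine le_trans (le_of_eq (eLpNorm_congr_ae ?_)) (hmain.trans ?_)
  · filter_upwards [integrableOn_snd_jumpShell hν hN le_rfl le_rfl (ε := ε) hδ 2] with ω hω
    have h := sum_setIntegral_grid (measurableSet_jumpShell δ ε) hh n
      (f := fun z : ℝ × ℝ => z.2 ^ 2) (μ := N ω) (by rwa [hnT])
    rw [hnT] at h
    rw [← h, ← Finset.sum_sub_distrib, Finset.sum_range]
    refine Finset.sum_congr rfl fun i _ => ?_
    rw [compShell_eq (hlo i) (hmid i) (hhi i), setIntegral_truncate _ _ _ _ _ (fun x => x ^ 2)]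
  · refine ENNReal.ofReal_le_ofReal (Real.sqrt_le_sqrt ?_)
    have hval : ∀ i : Fin n, ∫ z in A i, truncate ε z.2 ^ 2
        ∂((volume.restrict (Set.Icc 0 T)).prod ν) ≤ T / n * smallMoment ν 2 ε := fun i => by
      rw [setIntegral_truncate _ _ _ _ _ (fun x => x ^ 2),
        setIntegral_prod_Ioc (hlo i) (hmid i) (hhi i) _ (fun x => x ^ 2), smul_eq_mul,
        show (((i : ℕ) : ℝ) + 1) * (T / n) - (i : ℕ) * (T / n) = T / n by ring]
      exact mul_le_mul_of_nonneg_left (setIntegral_mono_set (hν.integrableOn_pow 0 ε)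
        (ae_of_all _ fun x => sq_nonneg x) (ae_of_all _ hsub)) hh
    refine mul_le_mul_of_nonneg_left ?_ zero_le_two
    calc _ ≤ ∑ _i : Fin n, (T / n * smallMoment ν 2 ε) ^ 2 :=
          Finset.sum_le_sum fun i _ => pow_le_pow_left₀
            (integral_nonneg fun z => sq_nonneg _) (hval i) 2
      _ = (n * (T / n)) * (T / n) * smallMoment ν 2 ε ^ 2 := by
          rw [Finset.sum_const, Finset.card_univ, Fintype.card_fin, nsmul_eq_mul]; ring
      _ = _ := by rw [hnT]

/-- The sum of squared increments, up to its drift part, is close to the sum of the squared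
jumps. -/
lemma eventually_eLpNorm_sumSqIncrements_sub_le (hT : 0 ≤ T) {n : ℕ} (hn : n ≠ 0) {ε η : ℝ}
    (hε : 0 ≤ ε) (hη : 0 < η) : ∀ᶠ δ in 𝓝[>] 0,
    eLpNorm (fun ω => sumSqIncrements P N ν n (T / n) ε ω - T * (T / n) * midDrift ν ε ^ 2 -
      ∫ z in Set.Ioc 0 T ×ˢ jumpShell δ ε, z.2 ^ 2 ∂(N ω)) 1 P ≤
      ENNReal.ofReal (√(2 * (T * (T / n) * smallMoment ν 2 ε ^ 2)) +
        |2 * (T / n) * midDrift ν ε| * √(T * smallMoment ν 2 ε) + η) := by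
  have := hν.sigmaFinite
  have hn' : (n : ℝ) ≠ 0 := Nat.cast_ne_zero.2 hn
  have hnT : (n : ℝ) * (T / n) = T := mul_div_cancel₀ T hn'
  have hh : 0 ≤ T / n := div_nonneg hT n.cast_nonneg
  set h := T / n with hh_def
  set d := midDrift ν ε
  have hlo : ∀ i : ℕ, 0 ≤ (i : ℝ) * h := fun i => by positivity
  have hmid : ∀ i : ℕ, (i : ℝ) * h ≤ ((i : ℝ) + 1) * h := fun i => by nlinarith
  have hhi : ∀ i ∈ Finset.range n, ((i : ℝ) + 1) * h ≤ T := fun i hi => by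
    calc ((i : ℝ) + 1) * h ≤ n * h :=
          mul_le_mul_of_nonneg_right (by exact_mod_cast Finset.mem_range.1 hi) hh
      _ = T := hnT
  let Z : ℕ → Ω → ℝ := fun i => compSmallJumps P N ν ((i : ℝ) * h) (((i : ℝ) + 1) * h) ε
  let Y : ℝ → ℕ → Ω → ℝ := fun δ i => compShell N ν ((i : ℝ) * h) (((i : ℝ) + 1) * h) ε δ
  let Q : ℝ → Ω → ℝ := fun δ ω => ∫ z in Set.Ioc 0 T ×ˢ jumpShell δ ε, z.2 ^ 2 ∂(N ω)
  let b := ENNReal.ofReal √(h * smallMoment ν 2 ε)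
  have hZ : ∀ i, MemLp (Z i) 2 P := fun i => memLp_compSmallJumps _ _ _ _ _ _
  have hYm : ∀ δ, 0 < δ → ∀ i ∈ Finset.range n, AEStronglyMeasurable (Y δ i) P :=
    fun δ hδ i hi => aestronglyMeasurable_compShell hν hN (hlo i) (hmid i) (hhi i hi) hε hδ
  have hYb : ∀ δ, 0 < δ → ∀ i ∈ Finset.range n, eLpNorm (Y δ i) 2 P ≤ b := fun δ hδ i hi => by
    have := eLpNorm_compShell_le hν hN (hlo i) (hmid i) (hhi i hi) hε hδ
    rwa [show ((i : ℝ) + 1) * h - i * h = h by ring] at this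
  have hlim : ∀ i ∈ Finset.range n,
      Tendsto (fun δ => eLpNorm (Y δ i - Z i) 2 P) (𝓝[>] 0) (𝓝 0) := fun i hi =>
    (isCompSmallJumps_compSmallJumps hν hN (hlo i) (hmid i) (hhi i hi) hε).2
  -- Total cost of replacing the `L²` limits `Z i` by the shell integrals `Y δ i`. As `n` is fixed
  -- while `δ ↓ 0`, no uniformity is needed.
  let g : ℝ → ℝ≥0∞ := fun δ => ∑ i ∈ Finset.range n,
    (eLpNorm (Y δ i - Z i) 2 P * (eLpNorm (Z i) 2 P + b) + ‖2 * h * d‖ₑ * eLpNorm (Y δ i - Z i) 2 P)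
  have hg : Tendsto g (𝓝[>] 0) (𝓝 0) := by
    have h0 : (0 : ℝ≥0∞) = ∑ i ∈ Finset.range n,
        (0 * (eLpNorm (Z i) 2 P + b) + ‖2 * h * d‖ₑ * 0) := by simp
    rw [h0]
    refine tendsto_finsetSum _ fun i hi => Tendsto.add ?_ ?_
    · exact ENNReal.Tendsto.mul_const (hlim i hi)
        (Or.inr (ENNReal.add_ne_top.2 ⟨(hZ i).2.ne, ENNReal.ofReal_ne_top⟩))
    · exact ENNReal.Tendsto.const_mul (hlim i hi) (Or.inr enorm_ne_top)
  filter_upwards [hg.eventually_le_const (ENNReal.ofReal_pos.2 hη), self_mem_nhdsWithin]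
    with δ hgδ hδ
  have hδ0 : 0 < δ := hδ
  have hQm : AEStronglyMeasurable (Q δ) P := aestronglyMeasurable_quadVar hν hN hδ0
  have hSYm : AEStronglyMeasurable (fun ω => ∑ i ∈ Finset.range n, Y δ i ω) P :=
    Finset.aestronglyMeasurable_fun_sum _ fun i hi => hYm δ hδ i hi
  have hSY2m : AEStronglyMeasurable (fun ω => ∑ i ∈ Finset.range n, Y δ i ω ^ 2) P :=
    Finset.aestronglyMeasurable_fun_sum _ fun i hi => (hYm δ hδ i hi).pow 2
  -- `F1` is `Z² - Y²`, factored for Cauchy–Schwarz; `F2` is the change in the cross term; `F3`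
  -- compares `∑ Y²` with the squared jumps; `F4` is the cross term for `Y`.
  let F1 : ℕ → Ω → ℝ := fun i ω => -((Y δ i - Z i) ω * (Z i + Y δ i) ω)
  let F2 : ℕ → Ω → ℝ := fun i => (2 * h * d) • (Y δ i - Z i)
  let F3 : Ω → ℝ := fun ω => ∑ i ∈ Finset.range n, Y δ i ω ^ 2 - Q δ ω
  let F4 : Ω → ℝ := (-(2 * h * d)) • fun ω => ∑ i ∈ Finset.range n, Y δ i ω
  have hF1m : ∀ i ∈ Finset.range n, AEStronglyMeasurable (F1 i) P := fun i hi =>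
    (((hYm δ hδ i hi).sub (hZ i).1).mul ((hZ i).1.add (hYm δ hδ i hi))).neg
  have hF2m : ∀ i ∈ Finset.range n, AEStronglyMeasurable (F2 i) P := fun i hi =>
    ((hYm δ hδ i hi).sub (hZ i).1).const_smul _
  have hF3m : AEStronglyMeasurable F3 P := hSY2m.sub hQm
  have hF4m : AEStronglyMeasurable F4 P := hSYm.const_smul _
  have hdecomp : (fun ω => sumSqIncrements P N ν n h ε ω - T * h * d ^ 2 - Q δ ω) =
      (∑ i ∈ Finset.range n, (F1 i + F2 i)) + (F3 + F4) := by
    funext ω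
    have hint : ∀ i : ℕ, ∫ _ in ((i : ℝ) * h)..(((i : ℝ) + 1) * h), d = h * d := fun i => by
      rw [intervalIntegral.integral_const, smul_eq_mul]; ring
    have hT' : T * h * d ^ 2 = ∑ _i ∈ Finset.range n, (h * d) ^ 2 := by
      rw [Finset.sum_const, Finset.card_range, nsmul_eq_mul, ← hnT]; ring
    simp only [sumSqIncrements, Pi.add_apply, Finset.sum_apply, F1, F2, F3, F4, Pi.smul_apply,
      smul_eq_mul, Pi.sub_apply]
    rw [hT', ← Finset.sum_sub_distrib, Finset.mul_sum, sub_add_eq_add_sub, ← add_sub_assoc,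
      ← Finset.sum_add_distrib, ← Finset.sum_add_distrib]
    congr 1
    refine Finset.sum_congr rfl fun i _ => ?_
    rw [hint]
    simp only [Z, Y]
    ring
  have hexp : ∀ {f : Ω → ℝ}, AEStronglyMeasurable f P → eLpNorm f 1 P ≤ eLpNorm f 2 P :=
    fun hf => eLpNorm_le_eLpNorm_of_exponent_le one_le_two hf
  have b12 : eLpNorm (∑ i ∈ Finset.range n, (F1 i + F2 i)) 1 P ≤ g δ := by
    refine (eLpNorm_sum_le (fun i hi => (hF1m i hi).add (hF2m i hi)) le_rfl).trans
      (Finset.sum_le_sum fun i hi => ?_)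
    refine (eLpNorm_add_le (hF1m i hi) (hF2m i hi) le_rfl).trans (add_le_add ?_ ?_)
    · have e : F1 i = -fun ω => (Y δ i - Z i) ω * (Z i + Y δ i) ω := rfl
      rw [e, eLpNorm_neg]
      refine (eLpNorm_mul_le_two ((hYm δ hδ i hi).sub (hZ i).1)
        ((hZ i).1.add (hYm δ hδ i hi))).trans ?_
      gcongr
      exact (eLpNorm_add_le (hZ i).1 (hYm δ hδ i hi) one_le_two).trans
        (add_le_add le_rfl (hYb δ hδ i hi))
    · refine (hexp (hF2m i hi)).trans ?_
      rw [eLpNorm_const_smul]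
  have b3 : eLpNorm F3 1 P ≤ ENNReal.ofReal √(2 * (T * h * smallMoment ν 2 ε ^ 2)) :=
    (hexp hF3m).trans (eLpNorm_sum_compShell_sq_sub_le hν hN hT hn hε hδ)
  have b4 : eLpNorm F4 1 P ≤ ENNReal.ofReal (|2 * h * d| * √(T * smallMoment ν 2 ε)) := by
    refine (hexp hF4m).trans ?_
    rw [eLpNorm_const_smul, enorm_neg, ENNReal.ofReal_mul (abs_nonneg _), Real.enorm_eq_ofReal_abs]
    gcongr
    rw [eLpNorm_congr_ae (sum_compShell_grid hν hN hT hn hδ)]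
    simpa using eLpNorm_compShell_le hν hN le_rfl hT le_rfl hε hδ0
  rw [hdecomp]
  calc eLpNorm ((∑ i ∈ Finset.range n, (F1 i + F2 i)) + (F3 + F4)) 1 P
      ≤ g δ + (eLpNorm F3 1 P + eLpNorm F4 1 P) := by
        refine (eLpNorm_add_le (Finset.aestronglyMeasurable_sum _ fun i hi =>
          (hF1m i hi).add (hF2m i hi)) (hF3m.add hF4m) le_rfl).trans (add_le_add b12 ?_)
        exact eLpNorm_add_le hF3m hF4m le_rfl
    _ ≤ ENNReal.ofReal η + (ENNReal.ofReal √(2 * (T * h * smallMoment ν 2 ε ^ 2)) +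
        ENNReal.ofReal (|2 * h * d| * √(T * smallMoment ν 2 ε))) :=
        add_le_add hgδ (add_le_add b3 b4)
    _ = _ := by
        rw [← ENNReal.ofReal_add (by positivity) (by positivity),
          ← ENNReal.ofReal_add (by positivity) (by positivity), add_comm]

end GridSums
-- Gaussian limit of the sum of squared jumps
section CentralLimit

/-- Second-order expansion of the exponent of the quadratic variation. -/
lemma norm_setIntegral_exp_sub_le {ν : Measure ℝ} (hν : IsLevyMeasure ν) {δ ε θ : ℝ} (hδ : 0 < δ)
    (hθ : |θ| * ε ^ 2 ≤ 1) :
    ‖∫ x in jumpShell δ ε, (Complex.exp ((θ * x ^ 2 : ℝ) * Complex.I) - 1) ∂ν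
      - (θ * ∫ x in jumpShell δ ε, x ^ 2 ∂ν : ℝ) * Complex.I
      + (θ ^ 2 / 2 * ∫ x in jumpShell δ ε, x ^ 4 ∂ν : ℝ)‖ ≤
      |θ| ^ 3 * ε ^ 2 * smallMoment ν 4 ε := by
  have hS := measurableSet_jumpShell δ ε
  have : IsFiniteMeasure (ν.restrict (jumpShell δ ε)) :=
    ⟨by simpa using hν.measure_jumpShell_lt_top hδ ε⟩
  have hsub : jumpShell δ ε ⊆ {x | |x| ≤ ε} := fun x hx => hx.2
  have i1 : IntegrableOn (fun x : ℝ => Complex.exp ((θ * x ^ 2 : ℝ) * Complex.I) - 1)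
      (jumpShell δ ε) ν := by
    refine Integrable.sub (Integrable.of_bound (by fun_prop) 1 (ae_of_all _ fun x => ?_))
      (integrable_const _)
    rw [Complex.norm_exp_ofReal_mul_I]
  have i2 : IntegrableOn (fun x : ℝ => ((θ * x ^ 2 : ℝ) : ℂ) * Complex.I) (jumpShell δ ε) ν :=
    (((hν.integrableOn_pow 0 ε).mono_set hsub).const_mul θ).ofReal.mul_const _
  have i12 : IntegrableOn (fun x : ℝ => Complex.exp ((θ * x ^ 2 : ℝ) * Complex.I) - 1 -
      ((θ * x ^ 2 : ℝ) : ℂ) * Complex.I) (jumpShell δ ε) ν := i1.sub i2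
  have i3 : IntegrableOn (fun x : ℝ => ((θ ^ 2 / 2 * x ^ 4 : ℝ) : ℂ)) (jumpShell δ ε) ν :=
    (((hν.integrableOn_pow 2 ε).mono_set hsub).const_mul (θ ^ 2 / 2)).ofReal
  have i4 : IntegrableOn (fun x : ℝ => |θ| ^ 3 * ε ^ 2 * x ^ 4) (jumpShell δ ε) ν :=
    ((hν.integrableOn_pow 2 ε).mono_set hsub).const_mul _
  have e2 : ∫ x in jumpShell δ ε, ((θ * x ^ 2 : ℝ) : ℂ) * Complex.I ∂ν =
      (θ * ∫ x in jumpShell δ ε, x ^ 2 ∂ν : ℝ) * Complex.I := by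
    rw [integral_mul_const, integral_complex_ofReal, integral_const_mul]
  have e3 : ∫ x in jumpShell δ ε, ((θ ^ 2 / 2 * x ^ 4 : ℝ) : ℂ) ∂ν =
      (θ ^ 2 / 2 * ∫ x in jumpShell δ ε, x ^ 4 ∂ν : ℝ) := by
    rw [integral_complex_ofReal, integral_const_mul]
  rw [← e2, ← e3, ← integral_sub i1 i2, ← integral_add i12 i3]
  calc _ ≤ ∫ x in jumpShell δ ε, |θ| ^ 3 * ε ^ 2 * x ^ 4 ∂ν := by
        refine norm_integral_le_of_norm_le i4 ((ae_restrict_iff' hS).2 (ae_of_all _ fun x hx => ?_))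
        have hx2 : x ^ 2 ≤ ε ^ 2 := by
          rw [← sq_abs x]
          exact pow_le_pow_left₀ (abs_nonneg _) hx.2 _
        have hn : ‖((θ * x ^ 2 : ℝ) : ℂ) * Complex.I‖ = |θ| * x ^ 2 := by
          rw [norm_mul, Complex.norm_I, mul_one, Complex.norm_real, Real.norm_eq_abs, abs_mul,
            abs_of_nonneg (sq_nonneg x)]
        have h1 : ‖((θ * x ^ 2 : ℝ) : ℂ) * Complex.I‖ ≤ 1 := by
          rw [hn]
          exact (mul_le_mul_of_nonneg_left hx2 (abs_nonneg _)).trans hθ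
        have h2 := Complex.exp_bound h1 (n := 3) (by norm_num)
        have h3 : Complex.exp ((θ * x ^ 2 : ℝ) * Complex.I) - 1 - ((θ * x ^ 2 : ℝ) : ℂ) * Complex.I
            + ((θ ^ 2 / 2 * x ^ 4 : ℝ) : ℂ) = Complex.exp ((θ * x ^ 2 : ℝ) * Complex.I) -
            ∑ m ∈ Finset.range 3, (((θ * x ^ 2 : ℝ) : ℂ) * Complex.I) ^ m / m.factorial := by
          simp only [Finset.sum_range_succ, Finset.sum_range_zero, Nat.factorial, mul_pow,
            Complex.I_sq]
          push_cast
          ring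
        rw [h3]
        refine h2.trans ?_
        rw [hn]
        have h4 : (((3 : ℕ).succ : ℝ) * (((3 : ℕ).factorial : ℝ) * (3 : ℕ))⁻¹) ≤ 1 := by
          norm_num [Nat.factorial]
        calc _ ≤ (|θ| * x ^ 2) ^ 3 := mul_le_of_le_one_right (by positivity) h4
          _ = |θ| ^ 3 * x ^ 2 * x ^ 4 := by ring
          _ ≤ |θ| ^ 3 * ε ^ 2 * x ^ 4 := by gcongr
    _ = |θ| ^ 3 * ε ^ 2 * ∫ x in jumpShell δ ε, x ^ 4 ∂ν := integral_const_mul _ _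
    _ ≤ |θ| ^ 3 * ε ^ 2 * smallMoment ν 4 ε := by
        gcongr
        exact setIntegral_mono_set (hν.integrableOn_pow 2 ε)
          (ae_of_all _ fun x => by positivity) (ae_of_all _ hsub)

lemma charFun_map_sub_div {Ω : Type*} [MeasurableSpace Ω] {P : Measure Ω} {X : Ω → ℝ}
    (hX : AEMeasurable X P) (M s t : ℝ) :
    charFun (P.map fun ω => (X ω - M) / s) t =
      charFun (P.map X) (t / s) * Complex.exp (-(t / s * M : ℝ) * Complex.I) := by
  have h1 : (fun ω => (X ω - M) / s) = fun ω => s⁻¹ * (X ω + -M) := by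
    funext ω; rw [div_eq_inv_mul, sub_eq_add_neg]
  rw [h1, charFun_map_mul_comp (hX.add_const _)]
  have h2 : P.map (fun ω => X ω + -M) = (P.map X).map (· + -M) :=
    (AEMeasurable.map_map_of_aemeasurable (g := (· + -M)) (by fun_prop) hX).symm
  rw [h2, charFun_map_add_const, div_eq_inv_mul]
  congr 2
  simp only [Real.inner_apply]
  push_cast
  ring

variable {Ω : Type*} [MeasurableSpace Ω] {P : Measure Ω} {ν : Measure ℝ} {T : ℝ}
  {N : Ω → Measure (ℝ × ℝ)} (hν : IsLevyMeasure ν)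
  (hN : IsPoissonRandomMeasure P N ((volume.restrict (Set.Icc 0 T)).prod ν))
include hν hN

variable [IsProbabilityMeasure P]

lemma charFun_quadVar (hT : 0 ≤ T) {δ ε : ℝ} (hδ : 0 < δ) (hε : 0 ≤ ε) (t : ℝ) :
    charFun (P.map fun ω => ∫ z in Set.Ioc 0 T ×ˢ jumpShell δ ε, z.2 ^ 2 ∂(N ω)) t =
      Complex.exp (T * ∫ x in jumpShell δ ε, (Complex.exp ((t * x ^ 2 : ℝ) * Complex.I) - 1) ∂ν) := by
  have := hν.sigmaFinite
  have h := hN.charFun_setIntegral (f := fun z : ℝ × ℝ => truncate ε z.2 ^ 2)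
    (C := ε ^ 2) (measurableSet_Ioc.prod (measurableSet_jumpShell δ ε))
    (measure_prod_Ioc_lt_top le_rfl le_rfl (hν.measure_jumpShell_lt_top hδ ε) (s := 0) (t := T))
    (((measurable_truncate ε).comp measurable_snd).pow_const 2)
    (fun z => by
      rw [abs_pow]
      exact pow_le_pow_left₀ (abs_nonneg _) (abs_truncate_le hε z.2) 2) t
  simp only [setIntegral_truncate _ _ _ _ _ (fun x : ℝ => x ^ 2)] at h
  rw [h, setIntegral_truncate _ _ _ _ _
      (fun x : ℝ => Complex.exp ((t * x ^ 2 : ℝ) * Complex.I) - 1),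
    setIntegral_prod_Ioc le_rfl hT le_rfl _
      (fun x : ℝ => Complex.exp ((t * x ^ 2 : ℝ) * Complex.I) - 1), sub_zero, Complex.real_smul]

/-- Central limit theorem for the sum of squared jumps of size in `(δ n, ε n]`. -/
lemma tendstoInDistribution_quadVar (hT : 0 < T) {ε δ : ℕ → ℝ} (hε : ∀ n, 0 ≤ ε n)
    (hδ : ∀ n, 0 < δ n) (hδε : ∀ᶠ n in atTop, δ n ≤ ε n)
    (hpos : ∀ᶠ n in atTop, 0 < smallMoment ν 4 (ε n))
    (h1 : Tendsto (fun n => ε n ^ 2 / √(T * smallMoment ν 4 (ε n))) atTop (𝓝 0))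
    (h2 : Tendsto (fun n => smallMoment ν 4 (δ n) / smallMoment ν 4 (ε n)) atTop (𝓝 0)) :
    TendstoInDistribution (fun n ω =>
      (∫ z in Set.Ioc 0 T ×ˢ jumpShell (δ n) (ε n), z.2 ^ 2 ∂(N ω)
        - T * ∫ x in jumpShell (δ n) (ε n), x ^ 2 ∂ν) / √(T * smallMoment ν 4 (ε n)))
      atTop (id : ℝ → ℝ) (fun _ => P) (gaussianReal 0 1) where
  forall_aemeasurable n :=
    ((aestronglyMeasurable_quadVar hν hN (hδ n)).aemeasurable.sub_const _).div_const _
  aemeasurable_limit := aemeasurable_id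
  tendsto := by
    refine ProbabilityMeasure.tendsto_iff_tendsto_charFun.2 fun t => ?_
    simp only [ProbabilityMeasure.coe_mk, Measure.map_id, charFun_gaussianReal]
    let s : ℕ → ℝ := fun n => √(T * smallMoment ν 4 (ε n))
    -- `V` is the exponent of the characteristic function of the normalized variable and `-W` its
    -- quadratic part. `h2` makes the shell's fourth moment equivalent to `smallMoment ν 4 (ε n)`,
    -- so `W → t² / 2`, while the cubic remainder is at most `|t|³ ε² / s`.
    let V : ℕ → ℂ := fun n =>
      T * (∫ x in jumpShell (δ n) (ε n),
        (Complex.exp ((t / s n * x ^ 2 : ℝ) * Complex.I) - 1) ∂ν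
      - (t / s n * ∫ x in jumpShell (δ n) (ε n), x ^ 2 ∂ν : ℝ) * Complex.I)
    let W : ℕ → ℂ := fun n =>
      ((T * ((t / s n) ^ 2 / 2 * ∫ x in jumpShell (δ n) (ε n), x ^ 4 ∂ν) : ℝ) : ℂ)
    have hW : Tendsto W atTop (𝓝 ((t ^ 2 / 2 : ℝ) : ℂ)) := by
      refine (Complex.continuous_ofReal.tendsto _).comp ?_
      have h3 : Tendsto (fun n => t ^ 2 / 2 *
          (1 - smallMoment ν 4 (δ n) / smallMoment ν 4 (ε n))) atTop (𝓝 (t ^ 2 / 2)) := by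
        simpa using (h2.const_sub 1).const_mul (t ^ 2 / 2)
      refine h3.congr' ?_
      filter_upwards [hδε, hpos] with n hn hp
      have hs2 : s n ^ 2 = T * smallMoment ν 4 (ε n) := Real.sq_sqrt (by positivity)
      have hsub := hν.smallMoment_sub 2 hn
      rw [← hsub, div_pow, hs2]
      field_simp
    have hVW : Tendsto (fun n => V n + W n) atTop (𝓝 0) := by
      have hlim : Tendsto (fun n => |t| ^ 3 * (ε n ^ 2 / s n)) atTop (𝓝 0) := by
        simpa using h1.const_mul (|t| ^ 3)
      have hlim1 : Tendsto (fun n => |t| * (ε n ^ 2 / s n)) atTop (𝓝 0) := by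
        simpa using h1.const_mul |t|
      refine squeeze_zero_norm' ?_ hlim
      filter_upwards [hpos, hlim1.eventually_le_const one_pos] with n hp hle
      have hs2 : s n ^ 2 = T * smallMoment ν 4 (ε n) := Real.sq_sqrt (by positivity)
      have hs0 : 0 < s n := Real.sqrt_pos.2 (by positivity)
      have habs : |t / s n| = |t| / s n := by rw [abs_div, abs_of_pos hs0]
      have hb := norm_setIntegral_exp_sub_le hν (hδ n) (ε := ε n) (θ := t / s n)
        (by rw [habs]; exact le_of_eq_of_le (by ring) hle)
      have hVWe : V n + W n = T * (∫ x in jumpShell (δ n) (ε n),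
        (Complex.exp ((t / s n * x ^ 2 : ℝ) * Complex.I) - 1) ∂ν
        - (t / s n * ∫ x in jumpShell (δ n) (ε n), x ^ 2 ∂ν : ℝ) * Complex.I
        + ((t / s n) ^ 2 / 2 * ∫ x in jumpShell (δ n) (ε n), x ^ 4 ∂ν : ℝ)) := by
        simp only [V, W]
        push_cast
        ring
      rw [hVWe, norm_mul, Complex.norm_real, Real.norm_of_nonneg hT.le]
      refine (mul_le_mul_of_nonneg_left hb hT.le).trans (le_of_eq ?_)
      rw [habs]
      calc T * ((|t| / s n) ^ 3 * ε n ^ 2 * smallMoment ν 4 (ε n))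
          = (|t| / s n) ^ 3 * ε n ^ 2 * (T * smallMoment ν 4 (ε n)) := by ring
        _ = _ := by rw [← hs2]; field_simp
    have hV : Tendsto V atTop (𝓝 (-(t ^ 2 / 2 : ℝ) : ℂ)) := by
      have := hVW.sub hW
      simpa using this
    have hexp := (Complex.continuous_exp.tendsto _).comp hV
    have hgoal : Complex.exp (t * (0 : ℝ) * Complex.I - ((1 : ℝ≥0) : ℝ) * t ^ 2 / 2) =
        Complex.exp (-(t ^ 2 / 2 : ℝ)) := by
      congr 1
      push_cast
      simp
    rw [hgoal]
    refine hexp.congr fun n => ?_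
    rw [charFun_map_sub_div (aestronglyMeasurable_quadVar hν hN (hδ n)).aemeasurable,
      charFun_quadVar hν hN hT.le (hδ n) (hε n), ← Complex.exp_add]
    simp only [Function.comp, V, s]
    congr 1
    push_cast
    ring

end CentralLimit
-- Comparison with the normalized sum, and conclusion
section Assembly

variable {Ω : Type*} [MeasurableSpace Ω] {P : Measure Ω} {ν : Measure ℝ} {T : ℝ}
  {N : Ω → Measure (ℝ × ℝ)}

lemma aestronglyMeasurable_sumSqIncrements (n : ℕ) (h ε : ℝ) :
    AEStronglyMeasurable (sumSqIncrements P N ν n h ε) P :=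
  Finset.aestronglyMeasurable_fun_sum _ fun _ _ =>
    ((memLp_compSmallJumps _ _ _ _ _ _).1.sub aestronglyMeasurable_const).pow 2

lemma aestronglyMeasurable_normalizedSum (α c : ℝ) (n : ℕ) (h ε : ℝ) :
    AEStronglyMeasurable (normalizedSum P N ν T α c n h ε) P := by
  exact ((((aestronglyMeasurable_sumSqIncrements n h ε).aemeasurable.sub_const _).sub_const
    _).div_const _).aestronglyMeasurable

lemma tendsto_smallMoment_four (hν : IsLevyMeasure ν) :
    Tendsto (smallMoment ν 4) (𝓝[>] 0) (𝓝 0) := by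
  have h1 : Tendsto (fun ε : ℝ => ε ^ 2 * smallMoment ν 2 ε) (𝓝[>] 0) (𝓝 0) := by
    have h2 : Tendsto (fun ε : ℝ => ε ^ 2) (𝓝[>] 0) (𝓝 0) := by
      have := (continuous_pow (M := ℝ) 2).tendsto 0
      simp only [ne_eq, OfNat.ofNat_ne_zero, not_false_eq_true, zero_pow] at this
      exact this.mono_left nhdsWithin_le_nhds
    simpa using h2.mul hν.tendsto_smallMoment_two
  exact squeeze_zero (fun ε => smallMoment_nonneg ν (by decide) ε)
    (fun ε => hν.smallMoment_add_two_le (j := 0) (by simp) ε) h1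

lemma sqrt_ell_mul_rpow {α ε : ℝ} (hT : 0 ≤ T) (hε : 0 < ε) :
    √T * √(ell ν α 4 ε) * ε ^ (2 - α / 2) = √(T * smallMoment ν 4 ε) := by
  have h3 : ε ^ (2 - α / 2) = √(ε ^ (4 - α)) := by
    rw [Real.sqrt_eq_rpow, ← Real.rpow_mul hε.le]
    ring_nf
  have hp : 0 < ε ^ (4 - α) := Real.rpow_pos_of_pos hε _
  have h4 : ell ν α 4 ε = smallMoment ν 4 ε / ε ^ (4 - α) := by
    rw [ell]
    norm_num
  rw [h3, mul_assoc, h4, ← Real.sqrt_mul (div_nonneg (smallMoment_nonneg ν (by decide) ε) hp.le),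
    div_mul_cancel₀ _ hp.ne', Real.sqrt_mul hT]

lemma ell_two_mul_rpow {α ε : ℝ} (hε : 0 < ε) :
    ell ν α 2 ε * ε ^ (2 - α) = smallMoment ν 2 ε := by
  rw [ell, Nat.cast_ofNat, div_mul_cancel₀ _ (Real.rpow_pos_of_pos hε _).ne']

lemma eLpNorm_const_div_le [IsProbabilityMeasure P] {f : Ω → ℝ} (hf : AEStronglyMeasurable f P)
    {b s : ℝ} (hb : 0 ≤ b) (hs : 0 < s) (h : eLpNorm f 1 P ≤ ENNReal.ofReal b) (k : ℝ) :
    eLpNorm (fun ω => (f ω + k) / s) 1 P ≤ ENNReal.ofReal (b / s + |k / s|) := by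
  have e : (fun ω => (f ω + k) / s) = s⁻¹ • f + fun _ => k / s := by
    funext ω
    simp only [Pi.add_apply, Pi.smul_apply, smul_eq_mul]
    ring
  rw [e, ENNReal.ofReal_add (by positivity) (abs_nonneg _)]
  refine (eLpNorm_add_le (hf.const_smul _) aestronglyMeasurable_const le_rfl).trans
    (add_le_add ?_ ?_)
  · rw [eLpNorm_const_smul, Real.enorm_eq_ofReal_abs, abs_of_pos (inv_pos.2 hs), div_eq_inv_mul,
      ENNReal.ofReal_mul (inv_pos.2 hs).le]
    gcongr
  · rw [eLpNorm_const _ one_ne_zero (IsProbabilityMeasure.ne_zero P), Real.enorm_eq_ofReal_abs]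
    simp

open Classical in
/-- Deterministic bound of the distance of the normalized sum from the normalized quadratic
variation. -/
lemma eLpNorm_normalizedSum_sub_le [IsProbabilityMeasure P] (hν : IsLevyMeasure ν)
    (hN : IsPoissonRandomMeasure P N ((volume.restrict (Set.Icc 0 T)).prod ν)) (hT : 0 < T)
    {α c : ℝ} {n : ℕ} {ε δ η : ℝ} (hε : 0 < ε) (hδ : 0 < δ) (hδε : δ ≤ ε)
    (hpos : 0 < smallMoment ν 4 ε) (hh : T / n ≤ ε ^ 2) (hη : 0 ≤ η)
    (h2 : T * smallMoment ν 2 δ ≤ η * √(T * smallMoment ν 4 ε))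
    (hQ : eLpNorm (fun ω => sumSqIncrements P N ν n (T / n) ε ω - T * (T / n) * midDrift ν ε ^ 2 -
      ∫ z in Set.Ioc 0 T ×ˢ jumpShell δ ε, z.2 ^ 2 ∂(N ω)) 1 P ≤
      ENNReal.ofReal (√(2 * (T * (T / n) * smallMoment ν 2 ε ^ 2)) +
        |2 * (T / n) * midDrift ν ε| * √(T * smallMoment ν 2 ε) +
        η * √(T * smallMoment ν 4 ε))) :
    eLpNorm (fun ω => normalizedSum P N ν T α c n (T / n) ε ω -
      (∫ z in Set.Ioc 0 T ×ˢ jumpShell δ ε, z.2 ^ 2 ∂(N ω)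
        - T * ∫ x in jumpShell δ ε, x ^ 2 ∂ν) / √(T * smallMoment ν 4 ε)) 1 P ≤
      ENNReal.ofReal (√2 * |ε * smallMoment ν 2 ε / √(smallMoment ν 4 ε)| +
        2 * |ε ^ 2 * midDrift ν ε * √(smallMoment ν 2 ε) / √(smallMoment ν 4 ε)| +
        √T * |ε ^ 2 * (midDrift ν ε ^ 2 - ellOne ν α c ε ^ 2 * ε ^ (2 - 2 * α) *
          (if α = 1 then 0 else 1)) / √(smallMoment ν 4 ε)| + 2 * η) := by
  have hm2 := smallMoment_nonneg ν even_two ε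
  have hm2δ := smallMoment_nonneg ν even_two δ
  have hh0 : 0 ≤ T / n := div_nonneg hT.le n.cast_nonneg
  set h := T / n
  set d := midDrift ν ε
  set m := smallMoment ν 2 ε
  set r := √(smallMoment ν 4 ε) with hr
  have hr0 : 0 < r := Real.sqrt_pos.2 hpos
  set w := d ^ 2 - ellOne ν α c ε ^ 2 * ε ^ (2 - 2 * α) * (if α = 1 then 0 else 1) with hw
  have hsT : 0 < √T := Real.sqrt_pos.2 hT
  have hs : √(T * smallMoment ν 4 ε) = √T * r := Real.sqrt_mul hT.le _
  have hs0 : 0 < √T * r := mul_pos hsT hr0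
  have hTT : √T * √T = T := Real.mul_self_sqrt hT.le
  rw [hs] at h2 hQ ⊢
  -- The deterministic discrepancy: the error of centring the drift, and the part of the mean `T m₂`
  -- due to jumps of size at most `δ`, which the shell does not see.
  set k := T * h * w - T * smallMoment ν 2 δ with hk
  have hfun : (fun ω => normalizedSum P N ν T α c n h ε ω -
      (∫ z in Set.Ioc 0 T ×ˢ jumpShell δ ε, z.2 ^ 2 ∂(N ω)
        - T * ∫ x in jumpShell δ ε, x ^ 2 ∂ν) / (√T * r)) =
      fun ω => (sumSqIncrements P N ν n h ε ω - T * h * d ^ 2 -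
        ∫ z in Set.Ioc 0 T ×ˢ jumpShell δ ε, z.2 ^ 2 ∂(N ω) + k) / (√T * r) := by
    funext ω
    rw [normalizedSum, sqrt_ell_mul_rpow hT.le hε, hs, ← sub_div, mul_assoc T (ell ν α 2 ε),
      ell_two_mul_rpow hε, ← hν.smallMoment_sub 0 hδε, hk, hw]
    congr 1
    ring
  rw [hfun]
  refine (eLpNorm_const_div_le (((aestronglyMeasurable_sumSqIncrements n h ε).sub
    aestronglyMeasurable_const).sub (aestronglyMeasurable_quadVar hν hN hδ)) (by positivity) hs0
    hQ k).trans (ENNReal.ofReal_le_ofReal ?_)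
  have t1 : √(2 * (T * h * m ^ 2)) / (√T * r) ≤ √2 * |ε * m / r| := by
    rw [abs_of_nonneg (by positivity), Real.sqrt_mul zero_le_two, mul_assoc T,
      Real.sqrt_mul hT.le, Real.sqrt_mul hh0, Real.sqrt_sq hm2]
    have hle : √h ≤ ε := Real.sqrt_le_iff.2 ⟨hε.le, hh⟩
    calc √2 * (√T * (√h * m)) / (√T * r) = √2 * (√h * m / r) := by field_simp
      _ ≤ √2 * (ε * m / r) := by gcongr
  have t2 : |2 * h * d| * √(T * m) / (√T * r) ≤ 2 * |ε ^ 2 * d * √m / r| := by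
    rw [abs_div, abs_mul, abs_mul, abs_mul, abs_mul, abs_of_pos hr0, abs_two, abs_of_nonneg hh0,
      abs_of_nonneg (sq_nonneg ε), abs_of_nonneg (Real.sqrt_nonneg m), Real.sqrt_mul hT.le]
    calc 2 * h * |d| * (√T * √m) / (√T * r) = 2 * (h * |d| * √m / r) := by field_simp
      _ ≤ 2 * (ε ^ 2 * |d| * √m / r) := by gcongr
  have t3 : |k / (√T * r)| ≤ √T * |ε ^ 2 * w / r| + η := by
    rw [hk, sub_div]
    refine (abs_sub _ _).trans (add_le_add ?_ ?_)
    · have e1 : |T * h * w / (√T * r)| = T * h * |w| / (√T * r) := by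
        rw [abs_div, abs_of_pos hs0, abs_mul, abs_of_nonneg (mul_nonneg hT.le hh0)]
      have e2 : |ε ^ 2 * w / r| = ε ^ 2 * |w| / r := by
        rw [abs_div, abs_of_pos hr0, abs_mul, abs_of_nonneg (sq_nonneg ε)]
      rw [e1, e2]
      calc T * h * |w| / (√T * r) = √T * √T * h * |w| / (√T * r) := by rw [hTT]
        _ = √T * (h * |w| / r) := by field_simp
        _ ≤ √T * (ε ^ 2 * |w| / r) := by gcongr
    · rw [abs_of_nonneg (by positivity), div_le_iff₀ hs0]
      exact h2
  have t4 : η * (√T * r) / (√T * r) = η := mul_div_cancel_right₀ _ hs0.ne'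
  rw [add_div, add_div, t4]
  linarith

end Assembly

theorem theorem1 {Ω : Type*} [MeasurableSpace Ω] (P : Measure Ω) [IsProbabilityMeasure P]
    (T : ℝ) (hT : 0 < T) (ν : Measure ℝ) (hν : IsLevyMeasure ν)
    (N : Ω → Measure (ℝ × ℝ))
    (hN : IsPoissonRandomMeasure P N ((volume.restrict (Set.Icc 0 T)).prod ν))
    (α : ℝ) (hA1 : AssumptionA1 ν α) (hα : α ≠ 0)
    (u : ℝ) (hu0 : 0 < u) (hu : u ≤ 1 / 2) (c : ℝ) :
    TendstoInDistribution
      (fun (n : ℕ) (ω : Ω) => normalizedSum P N ν T α c n (T / n) ((T / n) ^ u) ω)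
      atTop (id : ℝ → ℝ) (fun _ => P) (gaussianReal 0 1) ∧
    (fun h : ℝ => ell ν α 2 (h ^ u)) =Θ[𝓝[>] 0] (fun _ => (1 : ℝ)) ∧
    (fun h : ℝ => ell ν α 4 (h ^ u)) =Θ[𝓝[>] 0] (fun _ => (1 : ℝ)) ∧
    (c ≠ 0 → (fun h : ℝ => ellOne ν α c (h ^ u)) =O[𝓝[>] 0] (fun _ => (1 : ℝ))) := by
  have hpow := tendsto_rpow_nhdsGT_zero hu0
  refine ⟨?_, ?_, ?_, fun hc => (ellOne_isBigO_one hν hA1 hc).comp_tendsto hpow⟩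
  · have hh : Tendsto (fun n : ℕ => T / n) atTop (𝓝[>] 0) := by
      refine tendsto_nhdsWithin_iff.2 ⟨tendsto_const_div_atTop_nhds_zero_nat T, ?_⟩
      filter_upwards [eventually_gt_atTop 0] with n hn
      exact div_pos hT (Nat.cast_pos.2 hn)
    let ε : ℕ → ℝ := fun n => (T / n) ^ u
    have hε : Tendsto ε atTop (𝓝[>] 0) := hpow.comp hh
    have hε0 : ∀ n, 0 ≤ ε n := fun n => Real.rpow_nonneg (div_nonneg hT.le n.cast_nonneg) _
    have hpos : ∀ᶠ n in atTop, 0 < smallMoment ν 4 (ε n) :=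
      hε.eventually (eventually_smallMoment_four_pos hν hA1)
    -- The role of `u ≤ 1 / 2`: the mesh is at most the squared truncation level once it is below
    -- `1`.
    have hhε : ∀ᶠ n : ℕ in atTop, T / n ≤ ε n ^ 2 := by
      filter_upwards [hh.eventually (Ioc_mem_nhdsGT one_pos)] with n hn
      calc T / n = (T / n) ^ (1 : ℝ) := (Real.rpow_one _).symm
        _ ≤ (T / n) ^ (u * (2 : ℕ)) :=
          Real.rpow_le_rpow_of_exponent_ge hn.1 hn.2 (by push_cast; linarith)
        _ = ε n ^ 2 := by rw [Real.rpow_mul hn.1.le, Real.rpow_natCast]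
    -- For each `n` all effects of discarding jumps up to `δ` vanish as `δ ↓ 0`, so one `δ` brings
    -- them below `1 / (n + 1)` of the relevant scale. Degenerate `n` receive an arbitrary positive
    -- value.
    have hδ : ∀ n : ℕ, ∃ δ : ℝ, 0 < δ ∧ (n ≠ 0 → 0 < ε n → 0 < smallMoment ν 4 (ε n) →
        δ ≤ ε n ∧
        T * smallMoment ν 2 δ ≤ 1 / ((n : ℝ) + 1) * √(T * smallMoment ν 4 (ε n)) ∧
        smallMoment ν 4 δ ≤ 1 / ((n : ℝ) + 1) * smallMoment ν 4 (ε n) ∧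
        eLpNorm (fun ω => sumSqIncrements P N ν n (T / n) (ε n) ω
          - T * (T / n) * midDrift ν (ε n) ^ 2 -
          ∫ z in Set.Ioc 0 T ×ˢ jumpShell δ (ε n), z.2 ^ 2 ∂(N ω)) 1 P ≤
          ENNReal.ofReal (√(2 * (T * (T / n) * smallMoment ν 2 (ε n) ^ 2)) +
            |2 * (T / n) * midDrift ν (ε n)| * √(T * smallMoment ν 2 (ε n)) +
            1 / ((n : ℝ) + 1) * √(T * smallMoment ν 4 (ε n)))) := by
      intro n
      by_cases hc : n ≠ 0 ∧ 0 < ε n ∧ 0 < smallMoment ν 4 (ε n)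
      · obtain ⟨hn, hεn, hm⟩ := hc
        have hη : 0 < 1 / ((n : ℝ) + 1) * √(T * smallMoment ν 4 (ε n)) := by positivity
        have hη' : 0 < 1 / ((n : ℝ) + 1) * smallMoment ν 4 (ε n) := by positivity
        have l2 : Tendsto (fun δ => T * smallMoment ν 2 δ) (𝓝[>] 0) (𝓝 0) := by
          simpa using hν.tendsto_smallMoment_two.const_mul T
        obtain ⟨δ, ⟨hδ0, hδε⟩, h2, h4, hQ⟩ := ((eventually_of_mem (Ioc_mem_nhdsGT hεn) fun _ h => h).and
          ((l2.eventually_le_const hη).and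
          (((tendsto_smallMoment_four hν).eventually_le_const hη').and
          (eventually_eLpNorm_sumSqIncrements_sub_le hν hN hT.le hn (hε0 n) hη)))).exists
        exact ⟨δ, hδ0, fun _ _ _ => ⟨hδε, h2, h4, hQ⟩⟩
      · exact ⟨1, one_pos, fun h1 h2 h3 => (hc ⟨h1, h2, h3⟩).elim⟩
    choose δ hδ0 hδ using hδ
    have hεpos : ∀ᶠ n in atTop, 0 < ε n := hε.eventually self_mem_nhdsWithin
    have hgood := (eventually_ne_atTop 0).and (hεpos.and hpos)
    have hinv : Tendsto (fun n : ℕ => 1 / ((n : ℝ) + 1)) atTop (𝓝 0) :=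
      tendsto_one_div_add_atTop_nhds_zero_nat
    have hQ := tendstoInDistribution_quadVar hν hN hT hε0 hδ0
      (hgood.mono fun n hn => (hδ n hn.1 hn.2.1 hn.2.2).1) hpos ?_ ?_
    -- Slutsky: the distance from the normalized quadratic variation tends to `0` in `L¹`, hence in
    -- probability.
    · refine tendstoInDistribution_of_tendstoInMeasure_sub _ _ hQ ?_
        (fun n => (aestronglyMeasurable_normalizedSum α c n _ _).aemeasurable)
      refine tendstoInMeasure_of_tendsto_eLpNorm one_ne_zero (fun n =>
        ((aestronglyMeasurable_normalizedSum α c n _ _).sub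
          (hQ.forall_aemeasurable n).aestronglyMeasurable)) aestronglyMeasurable_zero ?_
      simp only [sub_zero]
      have l1 := (tendsto_mul_smallMoment_two_div_sqrt_smallMoment_four hν hA1).comp hε
      have l2 := (tendsto_drift_cross_div_sqrt_smallMoment_four hν hA1).comp hε
      have l3 := (tendsto_drift_centering_div_sqrt_smallMoment_four hν hA1 hα c).comp hε
      have hbound := (((l1.abs.const_mul √2).add (l2.abs.const_mul 2)).add
        (l3.abs.const_mul √T)).add (hinv.const_mul 2)
      simp only [abs_zero, mul_zero, add_zero] at hbound
      have hbound' := ENNReal.tendsto_ofReal hbound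
      rw [ENNReal.ofReal_zero] at hbound'
      refine tendsto_of_tendsto_of_tendsto_of_le_of_le' tendsto_const_nhds hbound'
        (Eventually.of_forall fun _ => zero_le) ?_
      filter_upwards [hgood, hhε] with n hn hhn
      obtain ⟨hδε, h2, -, hQn⟩ := hδ n hn.1 hn.2.1 hn.2.2
      exact eLpNorm_normalizedSum_sub_le hν hN hT hn.2.1 (hδ0 n) hδε hn.2.2 hhn
        (by positivity) h2 hQn
    · have l := ((tendsto_sq_div_sqrt_smallMoment_four hν hA1 hα).comp hε).div_const √T
      rw [zero_div] at l
      refine l.congr fun n => ?_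
      rw [Function.comp, Real.sqrt_mul hT.le, div_div, mul_comm]
    · refine squeeze_zero' (Eventually.of_forall fun n => div_nonneg
        (smallMoment_nonneg ν (by decide) _) (smallMoment_nonneg ν (by decide) _)) ?_ hinv
      filter_upwards [hgood] with n hn
      rw [div_le_iff₀ hn.2.2]
      exact (hδ n hn.1 hn.2.1 hn.2.2).2.2.1
  · have h := ell_isTheta_one (j := 2) (α := α) (by simpa using hA1.2)
    exact ⟨h.1.comp_tendsto hpow, h.2.comp_tendsto hpow⟩
  · have h := ell_isTheta_one (j := 4) (α := α) (by simpa using smallMoment_four_isTheta hν hA1)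
    exact ⟨h.1.comp_tendsto hpow, h.2.comp_tendsto hpow⟩
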